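/- Consider two players with budgets $0<B_1\le B_2$ and finitely many projects $1,\dots,m$ with coefficients $\alpha_1,\dots,\alpha_m>0$. Player $i$ chooses contributions $x^i_j\ge 0$ to the projects with $\sum_j x^i_j\le B_i$. Project $j$ has the value $\alpha_j(x^1_j+x^2_j)$, which is divided equally among the players $i$ with $x^i_j\ge\theta\max(x^1_j,x^2_j)$; the utility of a player is the sum of her shares, and the social welfare is the sum of the utilities. In a game that has a pure Nash equilibrium, the price of stability ($\mathrm{PoS}$) and the price of anarchy ($\mathrm{PoA}$) are the ratios of the supremum, respectively the infimum, of the social welfare over all pure Nash equilibria to the maximum social welfare over all strategy profiles. Fix $0<\theta<1$ and an integer $k\ge 1$, and consider all such two-player games (with arbitrary $m$, $\alpha_1,\dots,\alpha_m$ and $B_1\le B_2$) in which exactly $k$ projects have the largest coefficient and which have a pure Nash equilibrium. Over all these games, the infimum of $\mathrm{PoS}$ is $\frac{k}{k+\theta}>\frac12$ and the maximum of $\mathrm{PoS}$ is $1$; the infimum of $\mathrm{PoA}$ is also $\frac{k}{k+\theta}$, and the supremum of $\mathrm{PoA}$ is $1$; this supremum is a maximum (i.e. is attained) if and only if $k\theta\le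 1$. -/

import Mathlib

/-- A shared effort game with linear project functions: player `i : N` has budget `B i > 0`,
and project `ω : Ω` with total contribution `y` has value `α ω * y`, where `α ω > 0`. -/
structure SharedEffortGame (N Ω : Type) where
  B : N → ℝ
  α : Ω → ℝ
  B_pos : ∀ i, 0 < B i
  α_pos : ∀ ω, 0 < α ω

namespace SharedEffortGame

variable {N Ω : Type} [Fintype N] [Fintype Ω]

/-- The strategies of player `i`: nonnegative contributions to the projects whose sum is at
most the budget of `i`. -/
def strategies (G : SharedEffortGame N Ω) (i : N) : Set (Ω → ℝ) :=
  {s | (∀ ω, 0 ≤ s ω) ∧ ∑ ω, s ω ≤ G.B i}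

/-- The strategy profiles; `x i ω` is the contribution of player `i` to project `ω`. -/
def profiles (G : SharedEffortGame N Ω) : Set (N → Ω → ℝ) :=
  {x | ∀ i, x i ∈ G.strategies i}

open Classical in
/-- The players who get a share of project `ω`: those who contribute at least a `θ` fraction of
the maximum contribution to `ω`. -/
noncomputable def winners (θ : ℝ) (x : N → Ω → ℝ) (ω : Ω) : Finset N :=
  {i | θ * (⨆ j, x j ω) ≤ x i ω}

open Classical in
/-- The share of player `i` in project `ω` under the `θ`-equal sharing mechanism: the value of
the project is divided equally between the winners. -/
noncomputable def share (G : SharedEffortGame N Ω) (θ : ℝ) (x : N → Ω → ℝ) (i : N) (ω : Ω) : ℝ :=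
  if i ∈ winners θ x ω then G.α ω * (∑ j, x j ω) / ((winners θ x ω).card : ℝ) else 0

noncomputable def utility (G : SharedEffortGame N Ω) (θ : ℝ) (x : N → Ω → ℝ) (i : N) : ℝ :=
  ∑ ω, G.share θ x i ω

noncomputable def socialWelfare (G : SharedEffortGame N Ω) (θ : ℝ) (x : N → Ω → ℝ) : ℝ :=
  ∑ i, G.utility θ x i

open Classical in
/-- The pure Nash equilibria: the profiles where no player has a profitable unilateral
deviation. -/
def equilibria (G : SharedEffortGame N Ω) (θ : ℝ) : Set (N → Ω → ℝ) :=
  {x | x ∈ G.profiles ∧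
    ∀ i, ∀ s ∈ G.strategies i, G.utility θ (Function.update x i s) i ≤ G.utility θ x i}

/-- The optimum social welfare over all strategy profiles. -/
noncomputable def optWelfare (G : SharedEffortGame N Ω) (θ : ℝ) : ℝ :=
  sSup (G.socialWelfare θ '' G.profiles)

/-- The price of stability: the social welfare of a best pure equilibrium, relative to the
optimum. Meaningful when a pure equilibrium exists. -/
noncomputable def PoS (G : SharedEffortGame N Ω) (θ : ℝ) : ℝ :=
  sSup (G.socialWelfare θ '' G.equilibria θ) / G.optWelfare θ

/-- The price of anarchy: the social welfare of a worst pure equilibrium, relative to the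
optimum. Meaningful when a pure equilibrium exists. -/
noncomputable def PoA (G : SharedEffortGame N Ω) (θ : ℝ) : ℝ :=
  sInf (G.socialWelfare θ '' G.equilibria θ) / G.optWelfare θ

open Classical in
/-- The steep projects: those with the largest coefficient. -/
noncomputable def steep (G : SharedEffortGame N Ω) : Finset Ω :=
  {ω | ∀ ω', G.α ω' ≤ G.α ω}

/-- `G` is one of the two-player games under consideration: the players are labelled so that
player `1` has at least the budget of player `0`, there are exactly `k` steep projects, and
a pure equilibrium exists. -/
def IsCase {m : ℕ} (G : SharedEffortGame (Fin 2) (Fin m)) (θ : ℝ) (k : ℕ) : Prop :=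
  G.B 0 ≤ G.B 1 ∧ G.steep.card = k ∧ (G.equilibria θ).Nonempty

/-- The prices of stability of all two-player games (with any number `m` of projects, any
coefficients and any budgets) that have `k` steep projects and a pure equilibrium. -/
def posValues (θ : ℝ) (k : ℕ) : Set ℝ :=
  {r | ∃ (m : ℕ) (G : SharedEffortGame (Fin 2) (Fin m)), G.IsCase θ k ∧ r = G.PoS θ}

/-- The prices of anarchy of all two-player games (with any number `m` of projects, any
coefficients and any budgets) that have `k` steep projects and a pure equilibrium. -/
def poaValues (θ : ℝ) (k : ℕ) : Set ℝ :=
  {r | ∃ (m : ℕ) (G : SharedEffortGame (Fin 2) (Fin m)), G.IsCase θ k ∧ r = G.PoA θ}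

end SharedEffortGame

/-! Let A be the largest coefficient. The larger contributor always gets a share, so all value is
handed out: the welfare is linear in the contributions and its optimum is A(B₀ + B₁).

If θB₁ ≤ B₀, each player can match a θ fraction of every contribution of the other, which secures
half of those projects, and spend the rest on a steep project. Adding the two equilibrium
inequalities shows that every equilibrium is optimal (`le_socialWelfare_of_comparable`).

If B₀ < θB₁, the rich player can secure A·B₁ by concentrating (`mul_budget_le_socialWelfare`).
Moreover, she leaves the poor player nothing on steep projects and, where both share a gentle
project, contributes at most the matching amount. A poor player who can afford a share in the steep
project that the rich one contributes least to, at most B₁/k, would therefore move there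
(`notMem_equilibria`). So an equilibrium forces kB₀ < θB₁, and the ratio is at least B₁/(B₀ + B₁) ≥
k/(k + θ).

The bound is approached by games with a nearly worthless decoy project, on which the poor player
spends everything in every equilibrium, with B₀/B₁ → θ/k. The value 1 comes from games whose
projects are all steep. Whether 1 is attained by the price of anarchy is settled by
`mul_le_one_of_PoA_eq_one` and, conversely, by equal budgets spread evenly over k equal projects. -/

namespace SharedEffortGame

/-- The share of a player who contributes `x` to a project with coefficient `a`, when the only
other player contributes `y`. -/
noncomputable def duoShare (θ a x y : ℝ) : ℝ :=
  if x < θ * y then 0 else if y < θ * x then a * (x + y) else a * (x + y) / 2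

/-! ### Shares in a single project with two contributors. -/

section DuoShare

variable {θ a x y : ℝ}

lemma duoShare_of_lt (h : x < θ * y) : duoShare θ a x y = 0 := by
  simp [duoShare, h]

lemma not_lt_of_dominates (hθ0 : 0 < θ) (hθ1 : θ < 1) (hx : 0 ≤ x) (h : y < θ * x) :
    ¬ x < θ * y := by
  intro h'
  have hy : 0 < y := pos_of_mul_pos_right (hx.trans_lt h') hθ0.le
  have h1 : θ * y ≤ y := mul_le_of_le_one_left hy.le hθ1.le
  have h2 : θ * x ≤ x := mul_le_of_le_one_left hx hθ1.le
  linarith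

lemma duoShare_of_dominates (hθ0 : 0 < θ) (hθ1 : θ < 1) (hx : 0 ≤ x) (h : y < θ * x) :
    duoShare θ a x y = a * (x + y) := by
  simp [duoShare, h, not_lt_of_dominates hθ0 hθ1 hx h]

lemma duoShare_of_both (h : θ * y ≤ x) (h' : θ * x ≤ y) :
    duoShare θ a x y = a * (x + y) / 2 := by
  simp [duoShare, not_lt.2 h, not_lt.2 h']

lemma duoShare_zero_right (hθ0 : 0 < θ) (hx : 0 ≤ x) : duoShare θ a x 0 = a * x := by
  rcases hx.eq_or_lt with rfl | hx
  · simp [duoShare]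
  · have : 0 < θ * x := mul_pos hθ0 hx
    simp [duoShare, this, hx.not_gt]

lemma duoShare_nonneg (ha : 0 ≤ a) (hx : 0 ≤ x) (hy : 0 ≤ y) : 0 ≤ duoShare θ a x y := by
  unfold duoShare
  split_ifs <;> positivity

lemma duoShare_le (ha : 0 ≤ a) (hx : 0 ≤ x) (hy : 0 ≤ y) : duoShare θ a x y ≤ a * (x + y) := by
  have : 0 ≤ a * (x + y) := by positivity
  unfold duoShare
  split_ifs <;> linarith

lemma half_le_duoShare (ha : 0 ≤ a) (hx : 0 ≤ x) (hy : 0 ≤ y) (h : θ * y ≤ x) :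
    a * (x + y) / 2 ≤ duoShare θ a x y := by
  have : 0 ≤ a * (x + y) := by positivity
  unfold duoShare
  split_ifs <;> linarith

lemma duoShare_le_half (ha : 0 ≤ a) (hx : 0 ≤ x) (hy : 0 ≤ y) (h : θ * x ≤ y) :
    duoShare θ a x y ≤ a * (x + y) / 2 := by
  have : 0 ≤ a * (x + y) := by positivity
  unfold duoShare
  split_ifs <;> linarith

lemma duoShare_add_swap (hθ0 : 0 < θ) (hθ1 : θ < 1) (hx : 0 ≤ x) :
    duoShare θ a x y + duoShare θ a y x = a * (x + y) := by
  have h1 := not_lt_of_dominates hθ0 hθ1 hx (y := y)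
  unfold duoShare
  split_ifs with h2 h3 h4 <;> first | exact absurd h2 (h1 h3) | exact absurd h3 (h1 h2) | ring

end DuoShare

/-! ### Utilities, welfare and optimum of a two-player game. -/

section TwoPlayers

lemma univ_eq_pair {i j : Fin 2} : i ≠ j → (Finset.univ : Finset (Fin 2)) = {i, j} := by
  revert i j; decide

variable {Ω : Type} [Fintype Ω] {G : SharedEffortGame (Fin 2) Ω} {θ : ℝ}
  {x : Fin 2 → Ω → ℝ} {i j : Fin 2}

omit [Fintype Ω] in
lemma share_eq_duoShare (hθ0 : 0 < θ) (hθ1 : θ < 1) (hx : ∀ l ω, 0 ≤ x l ω) (hij : i ≠ j)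
    (ω : Ω) : G.share θ x i ω = duoShare θ (G.α ω) (x i ω) (x j ω) := by
  have hi := hx i ω
  have hj := hx j ω
  have huniv : (Finset.univ : Finset (Fin 2)) = {i, j} :=
    univ_eq_pair hij
  have hsup : (⨆ l, x l ω) = max (x i ω) (x j ω) := by
    rw [← Finset.sup'_univ_eq_ciSup]
    apply le_antisymm
    · apply Finset.sup'_le
      intro l hl
      rw [huniv] at hl
      rcases Finset.mem_insert.1 hl with rfl | hl
      · exact le_max_left _ _
      · rw [Finset.mem_singleton.1 hl]; exact le_max_right _ _
    · exact max_le (Finset.le_sup' (fun l => x l ω) (Finset.mem_univ i))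
        (Finset.le_sup' (fun l => x l ω) (Finset.mem_univ j))
  -- A contribution always reaches θ times itself, so only the comparison with the other player
  -- matters.
  have key : ∀ u v : ℝ, 0 ≤ u → 0 ≤ v → (θ * max u v ≤ u ↔ θ * v ≤ u) := by
    intro u v hu hv
    rw [mul_max_of_nonneg _ _ hθ0.le, max_le_iff]
    exact ⟨fun h => h.2, fun h => ⟨by nlinarith, h⟩⟩
  have hmi : i ∈ winners θ x ω ↔ θ * x j ω ≤ x i ω := by
    simp only [winners, Finset.mem_filter, Finset.mem_univ, true_and, hsup]
    exact key _ _ hi hj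
  have hmj : j ∈ winners θ x ω ↔ θ * x i ω ≤ x j ω := by
    simp only [winners, Finset.mem_filter, Finset.mem_univ, true_and, hsup]
    rw [max_comm]
    exact key _ _ hj hi
  have hsum : ∑ l, x l ω = x i ω + x j ω := by
    rw [huniv, Finset.sum_pair hij]
  have hsub : winners θ x ω ⊆ {i, j} := huniv ▸ Finset.subset_univ _
  unfold share
  rw [hsum]
  by_cases h1 : i ∈ winners θ x ω
  · rw [if_pos h1]
    by_cases h2 : j ∈ winners θ x ω
    · have : winners θ x ω = {i, j} := by
        apply hsub.antisymm
        intro l hl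
        rcases Finset.mem_insert.1 hl with rfl | hl
        · exact h1
        · rwa [Finset.mem_singleton.1 hl]
      rw [this, Finset.card_pair hij, duoShare_of_both (hmi.1 h1) (hmj.1 h2)]
      norm_num
    · have : winners θ x ω = {i} := by
        apply Finset.Subset.antisymm
        · intro l hl
          rcases Finset.mem_insert.1 (hsub hl) with rfl | hl'
          · exact Finset.mem_singleton_self _
          · rw [Finset.mem_singleton.1 hl'] at hl
            exact absurd hl h2
        · simpa using h1
      rw [hmj, not_le] at h2
      rw [this, duoShare_of_dominates hθ0 hθ1 hi h2]
      simp
  · rw [if_neg h1]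
    rw [hmi, not_le] at h1
    rw [duoShare_of_lt h1]

lemma utility_eq_sum_duoShare (hθ0 : 0 < θ) (hθ1 : θ < 1) (hx : ∀ l ω, 0 ≤ x l ω)
    (hij : i ≠ j) : G.utility θ x i = ∑ ω, duoShare θ (G.α ω) (x i ω) (x j ω) :=
  Finset.sum_congr rfl fun ω _ => share_eq_duoShare hθ0 hθ1 hx hij ω

lemma socialWelfare_eq_add (hij : i ≠ j) :
    G.socialWelfare θ x = G.utility θ x i + G.utility θ x j := by
  have huniv : (Finset.univ : Finset (Fin 2)) = {i, j} :=
    univ_eq_pair hij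
  rw [socialWelfare, huniv, Finset.sum_pair hij]

lemma socialWelfare_eq (hθ0 : 0 < θ) (hθ1 : θ < 1) (hx : ∀ l ω, 0 ≤ x l ω) (hij : i ≠ j) :
    G.socialWelfare θ x = ∑ ω, G.α ω * x i ω + ∑ ω, G.α ω * x j ω := by
  rw [socialWelfare_eq_add hij, utility_eq_sum_duoShare hθ0 hθ1 hx hij,
    utility_eq_sum_duoShare hθ0 hθ1 hx hij.symm, ← Finset.sum_add_distrib,
    ← Finset.sum_add_distrib]
  refine Finset.sum_congr rfl fun ω _ => ?_
  rw [duoShare_add_swap hθ0 hθ1 (hx _ _)]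
  ring

lemma sum_duoShare_update (hθ0 : 0 < θ) (hθ1 : θ < 1) (hx : ∀ l ω, 0 ≤ x l ω) (hij : i ≠ j)
    {s : Ω → ℝ} (hs : ∀ ω, 0 ≤ s ω) :
    G.utility θ (Function.update x i s) i = ∑ ω, duoShare θ (G.α ω) (s ω) (x j ω) := by
  rw [utility_eq_sum_duoShare hθ0 hθ1 _ hij]
  · simp [Function.update_of_ne hij.symm]
  · intro l ω
    by_cases h : l = i
    · subst h; simpa using hs ω
    · simpa [Function.update_of_ne h] using hx l ω

lemma profiles_nonneg (hx : x ∈ G.profiles) (l : Fin 2) (ω : Ω) : 0 ≤ x l ω := (hx l).1 ω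

lemma deviation_le (hθ0 : 0 < θ) (hθ1 : θ < 1) (hx : x ∈ G.equilibria θ) (hij : i ≠ j)
    {s : Ω → ℝ} (hs : s ∈ G.strategies i) :
    ∑ ω, duoShare θ (G.α ω) (s ω) (x j ω) ≤ G.utility θ x i := by
  rw [← sum_duoShare_update hθ0 hθ1 (profiles_nonneg hx.1) hij hs.1]
  -- The two sides differ only in the decidability instance inside `Function.update`, which is
  -- classical in `equilibria`.
  convert hx.2 i s hs

lemma mem_equilibria_of (hθ0 : 0 < θ) (hθ1 : θ < 1) (hx : x ∈ G.profiles)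
    (h0 : ∀ s ∈ G.strategies 0,
      ∑ ω, duoShare θ (G.α ω) (s ω) (x 1 ω) ≤ ∑ ω, duoShare θ (G.α ω) (x 0 ω) (x 1 ω))
    (h1 : ∀ s ∈ G.strategies 1,
      ∑ ω, duoShare θ (G.α ω) (s ω) (x 0 ω) ≤ ∑ ω, duoShare θ (G.α ω) (x 1 ω) (x 0 ω)) :
    x ∈ G.equilibria θ := by
  have hn := profiles_nonneg hx
  have h01 : (0 : Fin 2) ≠ 1 := by decide
  have key : ∀ i j : Fin 2, i ≠ j → (∀ s ∈ G.strategies i,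
      ∑ ω, duoShare θ (G.α ω) (s ω) (x j ω) ≤ ∑ ω, duoShare θ (G.α ω) (x i ω) (x j ω)) →
      ∀ s ∈ G.strategies i, G.utility θ (Function.update x i s) i ≤ G.utility θ x i := by
    intro i j hij h s hs
    rw [sum_duoShare_update hθ0 hθ1 hn hij hs.1, utility_eq_sum_duoShare hθ0 hθ1 hn hij]
    exact h s hs
  refine ⟨hx, fun i s hs => ?_⟩
  have : G.utility θ (Function.update x i s) i ≤ G.utility θ x i := by
    fin_cases i
    · exact key 0 1 h01 h0 s hs
    · exact key 1 0 h01.symm h1 s hs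
  convert this

lemma utility_nonneg (hθ0 : 0 < θ) (hθ1 : θ < 1) (hx : x ∈ G.profiles) (i : Fin 2) :
    0 ≤ G.utility θ x i := by
  have hij : i ≠ i + 1 := by revert i; decide
  rw [utility_eq_sum_duoShare hθ0 hθ1 (profiles_nonneg hx) hij]
  exact Finset.sum_nonneg fun ω _ =>
    duoShare_nonneg (G.α_pos ω).le (profiles_nonneg hx _ _) (profiles_nonneg hx _ _)

lemma mem_steep {s : Ω} : s ∈ G.steep ↔ ∀ ω, G.α ω ≤ G.α s := by
  simp [steep]

lemma α_le_of_mem_steep {s : Ω} (hs : s ∈ G.steep) (ω : Ω) : G.α ω ≤ G.α s :=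
  mem_steep.1 hs ω

lemma α_eq_of_mem_steep {s t : Ω} (hs : s ∈ G.steep) (ht : t ∈ G.steep) : G.α s = G.α t :=
  le_antisymm (α_le_of_mem_steep ht s) (α_le_of_mem_steep hs t)

lemma α_lt_of_notMem_steep {s t : Ω} (hs : s ∈ G.steep) (ht : t ∉ G.steep) :
    G.α t < G.α s := by
  by_contra! h
  exact ht (mem_steep.2 fun ω => (α_le_of_mem_steep hs ω).trans h)

lemma sum_α_mul_le {s : Ω} (hs : s ∈ G.steep) (hx : x ∈ G.profiles) (i : Fin 2) :
    ∑ ω, G.α ω * x i ω ≤ G.α s * G.B i :=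
  calc ∑ ω, G.α ω * x i ω ≤ ∑ ω, G.α s * x i ω :=
        Finset.sum_le_sum fun ω _ =>
          mul_le_mul_of_nonneg_right (α_le_of_mem_steep hs ω) (profiles_nonneg hx _ _)
    _ = G.α s * ∑ ω, x i ω := by rw [Finset.mul_sum]
    _ ≤ G.α s * G.B i := mul_le_mul_of_nonneg_left (hx i).2 (G.α_pos s).le

lemma socialWelfare_le (hθ0 : 0 < θ) (hθ1 : θ < 1) {s : Ω} (hs : s ∈ G.steep)
    (hx : x ∈ G.profiles) : G.socialWelfare θ x ≤ G.α s * (G.B 0 + G.B 1) := by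
  rw [socialWelfare_eq hθ0 hθ1 (profiles_nonneg hx) (show (0 : Fin 2) ≠ 1 by decide)]
  linarith [sum_α_mul_le hs hx 0, sum_α_mul_le hs hx 1]

lemma single_mem_strategies [DecidableEq Ω] (s : Ω) (i : Fin 2) :
    (Pi.single s (G.B i) : Ω → ℝ) ∈ G.strategies i := by
  refine ⟨fun ω => ?_, by simp⟩
  by_cases h : ω = s
  · subst h; simpa using (G.B_pos i).le
  · simp [h]

lemma optWelfare_eq (hθ0 : 0 < θ) (hθ1 : θ < 1) {s : Ω} (hs : s ∈ G.steep) :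
    G.optWelfare θ = G.α s * (G.B 0 + G.B 1) := by
  classical
  apply IsGreatest.csSup_eq
  constructor
  · refine ⟨fun i => Pi.single s (G.B i), fun i => single_mem_strategies s i, ?_⟩
    rw [socialWelfare_eq hθ0 hθ1 (fun i => (single_mem_strategies s i).1)
      (show (0 : Fin 2) ≠ 1 by decide)]
    simp [Pi.single_apply]
    ring
  · rintro _ ⟨x, hx, rfl⟩
    exact socialWelfare_le hθ0 hθ1 hs hx

end TwoPlayers

end SharedEffortGame

namespace SharedEffortGame

/-! ### Matching and concentrating deviations. -/

section Comparable

variable {Ω : Type} [Fintype Ω] {G : SharedEffortGame (Fin 2) Ω} {θ : ℝ}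
  {x : Fin 2 → Ω → ℝ} {i j : Fin 2} {s : Ω}

open Classical in
lemma matching_mem_strategies (hθ0 : 0 < θ) (hx : x ∈ G.profiles)
    (hB : θ * G.B j ≤ G.B i) (s : Ω) :
    (fun ω => θ * x j ω + if ω = s then G.B i - θ * ∑ ω, x j ω else 0) ∈ G.strategies i := by
  have hr : 0 ≤ G.B i - θ * ∑ ω, x j ω := by
    have := mul_le_mul_of_nonneg_left (hx j).2 hθ0.le
    linarith
  refine ⟨fun ω => ?_, ?_⟩
  · have : 0 ≤ θ * x j ω := mul_nonneg hθ0.le (profiles_nonneg hx _ _)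
    dsimp only
    split_ifs <;> linarith
  · rw [Finset.sum_add_distrib, ← Finset.mul_sum]
    simp

/-- A player who can afford it gets at least half of all projects by matching a `θ` fraction of
each contribution of the other player and putting the remainder on a single project. -/
lemma matching_le_utility (hθ0 : 0 < θ) (hθ1 : θ < 1) (hx : x ∈ G.equilibria θ) (hij : i ≠ j)
    (hB : θ * G.B j ≤ G.B i) (s : Ω) :
    ((1 + θ) * ∑ ω, G.α ω * x j ω + G.α s * (G.B i - θ * ∑ ω, x j ω)) / 2
      ≤ G.utility θ x i := by
  classical
  have hn := profiles_nonneg hx.1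
  have hmem := matching_mem_strategies hθ0 hx.1 hB s
  refine le_trans ?_ (deviation_le hθ0 hθ1 hx hij hmem)
  set r := G.B i - θ * ∑ ω, x j ω
  calc ((1 + θ) * ∑ ω, G.α ω * x j ω + G.α s * r) / 2
      = ∑ ω, G.α ω * (θ * x j ω + (if ω = s then r else 0) + x j ω) / 2 := by
        rw [← Finset.sum_div]
        congr 1
        simp only [mul_add, Finset.sum_add_distrib, mul_ite, mul_zero, Finset.sum_ite_eq',
          Finset.mem_univ, if_true, add_mul, one_mul]
        have : ∑ ω, G.α ω * (θ * x j ω) = θ * ∑ ω, G.α ω * x j ω := by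
          rw [Finset.mul_sum]; exact Finset.sum_congr rfl fun _ _ => by ring
        rw [this]; ring
    _ ≤ _ := Finset.sum_le_sum fun ω _ => by
        have hr : 0 ≤ if ω = s then r else 0 := by
          have := mul_le_mul_of_nonneg_left (hx.1 j).2 hθ0.le
          split_ifs
          · simp only [r]; linarith
          · exact le_rfl
        exact half_le_duoShare (G.α_pos ω).le (hmem.1 ω) (hn _ _) (by linarith)

/-- If the remainder goes to a project which the other player does not contribute to, then it
counts in full. -/
lemma matching_le_utility_of_eq_zero (hθ0 : 0 < θ) (hθ1 : θ < 1) (hx : x ∈ G.equilibria θ)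
    (hij : i ≠ j) (hB : θ * G.B j ≤ G.B i) (hs : x j s = 0) :
    (1 + θ) / 2 * ∑ ω, G.α ω * x j ω + G.α s * (G.B i - θ * ∑ ω, x j ω)
      ≤ G.utility θ x i := by
  classical
  have hn := profiles_nonneg hx.1
  have hmem := matching_mem_strategies hθ0 hx.1 hB s
  refine le_trans ?_ (deviation_le hθ0 hθ1 hx hij hmem)
  have hr : 0 ≤ G.B i - θ * ∑ ω, x j ω := by
    have := mul_le_mul_of_nonneg_left (hx.1 j).2 hθ0.le
    linarith
  set r := G.B i - θ * ∑ ω, x j ω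
  calc (1 + θ) / 2 * ∑ ω, G.α ω * x j ω + G.α s * r
      = ∑ ω, ((1 + θ) / 2 * (G.α ω * x j ω) + if ω = s then G.α ω * r else 0) := by
        rw [Finset.sum_add_distrib, ← Finset.mul_sum]
        simp
    _ ≤ _ := Finset.sum_le_sum fun ω _ => by
        by_cases h : ω = s
        · subst h
          simp [hs, duoShare_zero_right hθ0 hr]
        · have := half_le_duoShare (θ := θ) (G.α_pos ω).le (hmem.1 ω) (hn j ω) (by simp [h])
          simp only [h, if_false, add_zero] at this ⊢
          linarith

/-- With budgets within a factor `θ` of each other, all equilibria are optimal. -/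
lemma le_socialWelfare_of_comparable (hθ0 : 0 < θ) (hθ1 : θ < 1) (hx : x ∈ G.equilibria θ)
    (h01 : θ * G.B 0 ≤ G.B 1) (h10 : θ * G.B 1 ≤ G.B 0) :
    G.α s * (G.B 0 + G.B 1) ≤ G.socialWelfare θ x := by
  have hne : (0 : Fin 2) ≠ 1 := by decide
  have h0 := matching_le_utility hθ0 hθ1 hx hne h10 s
  have h1 := matching_le_utility hθ0 hθ1 hx hne.symm h01 s
  have hsw := socialWelfare_eq_add (G := G) (θ := θ) (x := x) hne
  have hsw' := socialWelfare_eq (G := G) hθ0 hθ1 (profiles_nonneg hx.1) hne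
  have hA : 0 ≤ G.α s * θ := (mul_pos (G.α_pos s) hθ0).le
  have b0 := mul_le_mul_of_nonneg_left (hx.1 0).2 hA
  have b1 := mul_le_mul_of_nonneg_left (hx.1 1).2 hA
  -- The sum of `h0` and `h1` reads 2W ≥ (1 + θ)W + (1 - θ)A(B₀ + B₁), where W is the welfare and A
  -- = `G.α s`.
  have key : (1 - θ) * (G.α s * (G.B 0 + G.B 1)) ≤ (1 - θ) * G.socialWelfare θ x := by
    rw [hsw'] at hsw ⊢
    linarith
  exact le_of_mul_le_mul_left key (by linarith)

/-- Concentrating the whole budget on a project where the other player contributes little. -/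
lemma concentrate_le_utility (hθ0 : 0 < θ) (hθ1 : θ < 1) (hx : x ∈ G.equilibria θ)
    (hij : i ≠ j) (h : x j s < θ * G.B i) :
    G.α s * (G.B i + x j s) ≤ G.utility θ x i := by
  classical
  have hn := profiles_nonneg hx.1
  have hmem := single_mem_strategies (G := G) s i
  refine le_trans ?_ (deviation_le hθ0 hθ1 hx hij hmem)
  calc G.α s * (G.B i + x j s)
      = duoShare θ (G.α s) ((Pi.single s (G.B i) : Ω → ℝ) s) (x j s) := by
        rw [Pi.single_eq_same, duoShare_of_dominates hθ0 hθ1 (G.B_pos i).le h]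
    _ ≤ _ := Finset.single_le_sum
        (f := fun ω => duoShare θ (G.α ω) ((Pi.single s (G.B i) : Ω → ℝ) ω) (x j ω))
        (fun ω _ => duoShare_nonneg (G.α_pos ω).le (hmem.1 ω) (hn _ _)) (Finset.mem_univ s)

/-- The smallest contribution to a steep project is at most the average. -/
lemma exists_mem_steep_le (hx : x ∈ G.profiles) (hG : G.steep.Nonempty) (i : Fin 2) :
    ∃ s ∈ G.steep, (G.steep.card : ℝ) * x i s ≤ G.B i := by
  obtain ⟨s, hs, hmin⟩ := G.steep.exists_min_image (x i) hG
  refine ⟨s, hs, ?_⟩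
  calc (G.steep.card : ℝ) * x i s = ∑ ω ∈ G.steep, x i s := by simp
    _ ≤ ∑ ω ∈ G.steep, x i ω := Finset.sum_le_sum hmin
    _ ≤ ∑ ω, x i ω := Finset.sum_le_sum_of_subset_of_nonneg (Finset.subset_univ _)
        fun ω _ _ => profiles_nonneg hx _ _
    _ ≤ G.B i := (hx i).2

lemma mul_budget_le_socialWelfare (hθ0 : 0 < θ) (hθ1 : θ < 1) (hx : x ∈ G.equilibria θ)
    (hB : G.B 0 < θ * G.B 1) :
    G.α s * G.B 1 ≤ G.socialWelfare θ x := by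
  have hn := profiles_nonneg hx.1
  have hle : x 0 s ≤ G.B 0 :=
    (Finset.single_le_sum (fun ω _ => hn 0 ω) (Finset.mem_univ s)).trans (hx.1 0).2
  have h1 := concentrate_le_utility hθ0 hθ1 hx (i := 1) (j := 0) (s := s) (by decide)
    (by linarith)
  have h0 := utility_nonneg hθ0 hθ1 hx.1 0
  rw [socialWelfare_eq_add (i := 0) (j := 1) (by decide)]
  have := mul_nonneg (G.α_pos s).le (hn 0 s)
  linarith

end Comparable

/-! ### Best responses of a player more than 1/θ times as rich as the other. -/

section Rich

variable {Ω : Type} [Fintype Ω] {G : SharedEffortGame (Fin 2) Ω} {θ : ℝ}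
  {x : Fin 2 → Ω → ℝ} {i j : Fin 2} {s : Ω}

lemma surplus_le_steep {a t y : ℝ} (ha : 0 ≤ a) (ht : 0 ≤ t) (hy : 0 ≤ y) :
    duoShare θ a t y - a * t ≤ a * y := by
  have := duoShare_le (θ := θ) ha ht hy
  linarith

/-- Contributing more than what is needed to dominate a project does not increase the surplus
over the value of a steep project. -/
lemma surplus_le_surplus_min {a A t y ε : ℝ} (hθ0 : 0 < θ) (hθ1 : θ < 1) (ha : 0 ≤ a)
    (haA : a ≤ A) (ht : 0 ≤ t) (hy : 0 ≤ y) (hε : 0 < ε) :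
    duoShare θ a t y - A * t
      ≤ duoShare θ a (min t (y / θ + ε)) y - A * min t (y / θ + ε) := by
  rcases le_total t (y / θ + ε) with h | h
  · rw [min_eq_left h]
  · rw [min_eq_right h]
    have hpos : 0 ≤ y / θ + ε := by positivity
    have hd : y < θ * (y / θ + ε) := by
      rw [mul_add, mul_div_cancel₀ _ hθ0.ne']
      have := mul_pos hθ0 hε
      linarith
    rw [duoShare_of_dominates hθ0 hθ1 hpos hd]
    have := duoShare_le (θ := θ) ha ht hy
    nlinarith

/-- The much richer player `i` gets in total at least the surplus of any cheap strategy outside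
a steep project `s` which she dominates with the remaining budget. -/
lemma sum_surplus_le (hθ0 : 0 < θ) (hθ1 : θ < 1) (hx : x ∈ G.equilibria θ) (hij : i ≠ j)
    [DecidableEq Ω] {z : Ω → ℝ} (hz : ∀ ω, 0 ≤ z ω)
    (hlt : x j s < θ * (G.B i - ∑ ω ∈ Finset.univ.erase s, z ω)) :
    -- Each unit is charged `G.α s`, its return on the dominated project `s`; the term `G.α s * x j
    -- s` is the bonus for dominating `s`.
    ∑ ω ∈ Finset.univ.erase s, (duoShare θ (G.α ω) (z ω) (x j ω) - G.α s * z ω)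
      + G.α s * x j s
      ≤ ∑ ω, (duoShare θ (G.α ω) (x i ω) (x j ω) - G.α s * x i ω) := by
  have hn := profiles_nonneg hx.1
  set Z := ∑ ω ∈ Finset.univ.erase s, z ω
  have hpos : 0 < G.B i - Z := pos_of_mul_pos_right ((hn j s).trans_lt hlt) hθ0.le
  have hcongr : ∀ f : Ω → ℝ → ℝ, ∑ ω ∈ Finset.univ.erase s,
      f ω (Function.update z s (G.B i - Z) ω) = ∑ ω ∈ Finset.univ.erase s, f ω (z ω) :=
    fun f => Finset.sum_congr rfl fun ω hω => by
      rw [Function.update_of_ne (Finset.ne_of_mem_erase hω)]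
  have hmem : Function.update z s (G.B i - Z) ∈ G.strategies i := by
    constructor
    · intro ω
      by_cases h : ω = s
      · subst h; simpa using hpos.le
      · simpa [h] using hz ω
    · rw [← Finset.sum_erase_add _ _ (Finset.mem_univ s), hcongr fun _ t => t]
      simp [Z]
  have h := deviation_le hθ0 hθ1 hx hij hmem
  rw [← Finset.sum_erase_add _ _ (Finset.mem_univ s),
    hcongr fun ω t => duoShare θ (G.α ω) t (x j ω), Function.update_self,
    duoShare_of_dominates hθ0 hθ1 hpos.le hlt,
    utility_eq_sum_duoShare hθ0 hθ1 hn hij] at h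
  rw [Finset.sum_sub_distrib, Finset.sum_sub_distrib, ← Finset.mul_sum, ← Finset.mul_sum]
  have := mul_le_mul_of_nonneg_left (hx.1 i).2 (G.α_pos s).le
  linarith

/-- The slack that a much richer player has after dominating every project. -/
lemma exists_slack (hθ0 : 0 < θ) (hx : x ∈ G.profiles) (hB : G.B j < θ * G.B i) :
    ∃ ε > 0, ∑ ω, (x j ω / θ + ε) < G.B i := by
  have h1 : G.B j / θ < G.B i := by rw [div_lt_iff₀ hθ0]; linarith
  have hc : (0 : ℝ) < Fintype.card Ω + 1 := by positivity
  -- The extra part in the denominator keeps the inequality strict.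
  refine ⟨(G.B i - G.B j / θ) / (Fintype.card Ω + 1), div_pos (by linarith) hc, ?_⟩
  rw [Finset.sum_add_distrib, ← Finset.sum_div]
  have h2 : (∑ ω, x j ω) / θ ≤ G.B j / θ := by gcongr; exact (hx j).2
  have h3 : ∑ _ω : Ω, (G.B i - G.B j / θ) / (Fintype.card Ω + 1) < G.B i - G.B j / θ := by
    rw [Finset.sum_const, nsmul_eq_mul, Finset.card_univ, mul_div_assoc', div_lt_iff₀ hc]
    nlinarith
  linarith

/-- In equilibrium, the much richer player dominates the steep projects which the other player
contributes to. -/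
lemma duoShare_poor_steep (hθ0 : 0 < θ) (hθ1 : θ < 1) (hx : x ∈ G.equilibria θ) (hij : i ≠ j)
    (hB : G.B j < θ * G.B i) (hs : s ∈ G.steep) :
    duoShare θ (G.α s) (x j s) (x i s) = 0 := by
  classical
  have hn := profiles_nonneg hx.1
  obtain ⟨ε, hε, hslack⟩ := exists_slack hθ0 hx.1 hB
  have hz : ∀ ω, 0 ≤ min (x i ω) (x j ω / θ + ε) := fun ω =>
    le_min (hn _ _) (by have := hn j ω; positivity)
  -- Capping the contributions outside `s` loses no surplus and frees enough budget to dominate `s`;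
  -- hence the equilibrium surplus on `s` is already `G.α s * x j s`.
  have h := sum_surplus_le (s := s) hθ0 hθ1 hx hij hz (by
    rw [← Finset.sum_erase_add _ _ (Finset.mem_univ s)] at hslack
    have : ∑ ω ∈ Finset.univ.erase s, min (x i ω) (x j ω / θ + ε)
        ≤ ∑ ω ∈ Finset.univ.erase s, (x j ω / θ + ε) :=
      Finset.sum_le_sum fun ω _ => min_le_right _ _
    rw [← div_lt_iff₀' hθ0]
    linarith)
  have h2 : ∑ ω ∈ Finset.univ.erase s, (duoShare θ (G.α ω) (x i ω) (x j ω) - G.α s * x i ω)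
      ≤ _ := Finset.sum_le_sum fun ω _ => surplus_le_surplus_min hθ0 hθ1 (G.α_pos ω).le
        (α_le_of_mem_steep hs ω) (hn i ω) (hn j ω) hε
  rw [← Finset.sum_erase_add (a := s) Finset.univ (fun ω => duoShare θ (G.α ω) (x i ω) (x j ω)
    - G.α s * x i ω) (Finset.mem_univ s)] at h
  have h3 := duoShare_add_swap (a := G.α s) (y := x i s) hθ0 hθ1 (hn j s)
  have h4 := duoShare_nonneg (θ := θ) (G.α_pos s).le (hn j s) (hn i s)
  linarith

/-- In equilibrium, the contribution of the much richer player to a gentle project maximizes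
her surplus there over all contributions up to what is needed to dominate it. -/
lemma surplus_le_of_rich (hθ0 : 0 < θ) (hθ1 : θ < 1) (hx : x ∈ G.equilibria θ) (hij : i ≠ j)
    (hB : G.B j < θ * G.B i) (hs : s ∈ G.steep) {n : Ω} (hn' : n ∉ G.steep) {t : ℝ}
    (ht0 : 0 ≤ t) (ht : t ≤ x j n / θ) :
    duoShare θ (G.α n) t (x j n) - G.α s * t
      ≤ duoShare θ (G.α n) (x i n) (x j n) - G.α s * x i n := by
  classical
  have hn := profiles_nonneg hx.1
  have hns : n ≠ s := fun h => hn' (h ▸ hs)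
  obtain ⟨ε, hε, hslack⟩ := exists_slack hθ0 hx.1 hB
  -- The capped strategy again, now with the amount `t` under test on `n`.
  set z : Ω → ℝ := Function.update (fun ω => min (x i ω) (x j ω / θ + ε)) n t with hzdef
  have hz : ∀ ω, 0 ≤ z ω := fun ω => by
    by_cases h : ω = n
    · subst h; simpa [z] using ht0
    · simp only [z, Function.update_of_ne h]
      exact le_min (hn _ _) (by have := hn j ω; positivity)
  have hzle : ∀ ω, z ω ≤ x j ω / θ + ε := fun ω => by
    by_cases h : ω = n
    · subst h; simp only [z, Function.update_self]; linarith
    · simp only [z, Function.update_of_ne h]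
      exact min_le_right _ _
  have h := sum_surplus_le (s := s) hθ0 hθ1 hx hij hz (by
    rw [← Finset.sum_erase_add _ _ (Finset.mem_univ s)] at hslack
    have : ∑ ω ∈ Finset.univ.erase s, z ω ≤ ∑ ω ∈ Finset.univ.erase s, (x j ω / θ + ε) :=
      Finset.sum_le_sum fun ω _ => hzle ω
    rw [← div_lt_iff₀' hθ0]
    linarith)
  have hmem : n ∈ Finset.univ.erase s := Finset.mem_erase.2 ⟨hns, Finset.mem_univ _⟩
  have h2 : ∑ ω ∈ (Finset.univ.erase s).erase n,
      (duoShare θ (G.α ω) (x i ω) (x j ω) - G.α s * x i ω)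
      ≤ ∑ ω ∈ (Finset.univ.erase s).erase n,
      (duoShare θ (G.α ω) (z ω) (x j ω) - G.α s * z ω) := Finset.sum_le_sum fun ω hω => by
    simp only [z, Function.update_of_ne (Finset.ne_of_mem_erase hω)]
    exact surplus_le_surplus_min hθ0 hθ1 (G.α_pos ω).le
        (α_le_of_mem_steep hs ω) (hn i ω) (hn j ω) hε
  rw [← Finset.sum_erase_add (a := s) Finset.univ (fun ω => duoShare θ (G.α ω) (x i ω) (x j ω)
    - G.α s * x i ω) (Finset.mem_univ s),
    ← Finset.sum_erase_add (a := n) (Finset.univ.erase s) (fun ω =>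
      duoShare θ (G.α ω) (x i ω) (x j ω) - G.α s * x i ω) hmem,
    ← Finset.sum_erase_add (a := n) (Finset.univ.erase s) (fun ω =>
      duoShare θ (G.α ω) (z ω) (x j ω) - G.α s * z ω) hmem] at h
  have h3 := surplus_le_steep (θ := θ) (G.α_pos s).le (hn i s) (hn j s)
  simp only [show z n = t by simp [z]] at h
  linarith

end Rich

end SharedEffortGame

namespace SharedEffortGame

/-! ### No equilibrium when the poor player can afford a steep project. -/

section Nonexistence

variable {Ω : Type} [Fintype Ω] {G : SharedEffortGame (Fin 2) Ω} {θ : ℝ}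
  {x : Fin 2 → Ω → ℝ} {i j : Fin 2} {s : Ω}

lemma exists_gentle_bound (hs : s ∈ G.steep) :
    ∃ β, 0 ≤ β ∧ β < G.α s ∧ ∀ ω ∉ G.steep, G.α ω ≤ β := by
  classical
  -- Inserting 0 covers the case without gentle projects.
  let S : Finset ℝ := insert 0 (Finset.image G.α (G.steepᶜ))
  have hS : S.Nonempty := Finset.insert_nonempty _ _
  refine ⟨S.max' hS, S.le_max' 0 (Finset.mem_insert_self _ _), ?_, fun ω hω => ?_⟩
  · rw [Finset.max'_lt_iff]
    intro y hy
    rcases Finset.mem_insert.1 hy with rfl | hy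
    · exact G.α_pos s
    · obtain ⟨ω, hω, rfl⟩ := Finset.mem_image.1 hy
      exact α_lt_of_notMem_steep hs (Finset.mem_compl.1 hω)
  · exact S.le_max' _ (Finset.mem_insert_of_mem
      (Finset.mem_image_of_mem _ (Finset.mem_compl.2 hω)))

/-- What the poor player `j` gets from a gentle project in equilibrium. -/
lemma duoShare_poor_gentle_le (hθ0 : 0 < θ) (hθ1 : θ < 1) (hx : x ∈ G.equilibria θ)
    (hij : i ≠ j) (hB : G.B j < θ * G.B i) (hs : s ∈ G.steep) {n : Ω} (hn : n ∉ G.steep)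
    (hpos : x i n ≠ 0) :
    duoShare θ (G.α n) (x j n) (x i n) ≤ G.α n * ((1 + θ) / 2 * x j n) := by
  have hnn := profiles_nonneg hx.1
  have hy : 0 < x i n := lt_of_le_of_ne (hnn i n) hpos.symm
  have hα := α_lt_of_notMem_steep hs hn
  have h0 := surplus_le_of_rich hθ0 hθ1 hx hij hB hs hn le_rfl
    (div_nonneg (hnn j n) hθ0.le)
  rw [mul_zero, sub_zero] at h0
  have h0' := duoShare_nonneg (θ := θ) (G.α_pos n).le le_rfl (hnn j n)
  have hx0 := hnn j n
  by_cases h1 : x j n < θ * x i n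
  · rw [duoShare_of_lt h1]
    have := (G.α_pos n).le
    positivity
  push Not at h1
  have h2 : θ * x j n ≤ x i n := by
    by_contra! h2
    rw [duoShare_of_lt h2] at h0
    have := mul_pos (G.α_pos s) hy
    linarith
  -- Lowering a shared contribution to the matching amount loses at most `G.α n / 2` per unit and
  -- saves `G.α s`, so the rich player is not above that amount.
  have h3 := surplus_le_of_rich hθ0 hθ1 hx hij hB hs hn (t := θ * x j n)
    (mul_nonneg hθ0.le hx0) (by
      rw [le_div_iff₀ hθ0]
      nlinarith [mul_nonneg hθ0.le hx0])
  rw [duoShare_of_both h2 h1] at h3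
  have h4 := half_le_duoShare (θ := θ) (G.α_pos n).le (mul_nonneg hθ0.le hx0) hx0 le_rfl
  have h5 : x i n ≤ θ * x j n := by
    have := G.α_pos n
    by_contra! h5
    nlinarith
  rw [duoShare_of_both h1 h2]
  have := mul_le_mul_of_nonneg_left h5 (G.α_pos n).le
  linarith

/-- If the poor player is much poorer, but can afford a share in the steep project which the
rich player contributes least to, then there is no equilibrium. -/
lemma notMem_equilibria (hθ0 : 0 < θ) (hθ1 : θ < 1) (hij : i ≠ j) (hB : G.B j < θ * G.B i)
    (hs : s ∈ G.steep) (hsB : θ * x i s ≤ G.B j) : x ∉ G.equilibria θ := by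
  classical
  intro hx
  have hn := profiles_nonneg hx.1
  obtain ⟨β, hβ0, hβs, hβ⟩ := exists_gentle_bound hs
  have hA := G.α_pos s
  have hBj := G.B_pos j
  -- The gentle projects which the poor player has to herself: only there does a unit earn its full
  -- coefficient rather than at most (1 + θ)/2 of it.
  set P : Finset Ω := {ω | ω ∉ G.steep ∧ x i ω = 0} with hPdef
  have hP : ∀ ω, ω ∈ P ↔ ω ∉ G.steep ∧ x i ω = 0 := fun ω => by simp [P]
  have hsP : s ∉ P := fun h => ((hP s).1 h).1 hs
  set p := ∑ ω ∈ P, x j ω with hp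
  set g := ∑ ω ∈ P, G.α ω * x j ω with hg
  have hp0 : 0 ≤ p := Finset.sum_nonneg fun ω _ => hn j ω
  have hgp : g ≤ β * p := by
    rw [hp, Finset.mul_sum]
    exact Finset.sum_le_sum fun ω hω =>
      mul_le_mul_of_nonneg_right (hβ ω ((hP ω).1 hω).1) (hn j ω)
  have hg0 : 0 ≤ g := Finset.sum_nonneg fun ω _ => mul_nonneg (G.α_pos ω).le (hn j ω)
  have hsum : p + ∑ ω ∈ Pᶜ, x j ω ≤ G.B j := by
    rw [Finset.sum_add_sum_compl]
    exact (hx.1 j).2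
  have hR0 : 0 ≤ G.B j - p := by
    have : 0 ≤ ∑ ω ∈ Pᶜ, x j ω := Finset.sum_nonneg fun ω _ => hn j ω
    linarith
  have hu : G.utility θ x j ≤ g + β * ((1 + θ) / 2 * (G.B j - p)) := by
    rw [utility_eq_sum_duoShare hθ0 hθ1 hn hij.symm, ← Finset.sum_add_sum_compl P]
    refine add_le_add (Finset.sum_le_sum fun ω hω => ?_) ?_
    · rw [((hP ω).1 hω).2, duoShare_zero_right hθ0 (hn j ω)]
    · calc ∑ ω ∈ Pᶜ, duoShare θ (G.α ω) (x j ω) (x i ω)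
          ≤ ∑ ω ∈ Pᶜ, β * ((1 + θ) / 2 * x j ω) := Finset.sum_le_sum fun ω hω => by
            have hnn : 0 ≤ (1 + θ) / 2 * x j ω := by have := hn j ω; positivity
            by_cases h : ω ∈ G.steep
            · rw [duoShare_poor_steep hθ0 hθ1 hx hij hB h]
              positivity
            · have h' : x i ω ≠ 0 := fun h0 => Finset.mem_compl.1 hω ((hP ω).2 ⟨h, h0⟩)
              exact (duoShare_poor_gentle_le hθ0 hθ1 hx hij hB hs h h').trans
                (mul_le_mul_of_nonneg_right (hβ ω h) hnn)
        _ = β * ((1 + θ) / 2 * ∑ ω ∈ Pᶜ, x j ω) := by rw [Finset.mul_sum, Finset.mul_sum]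
        _ ≤ _ := by
            apply mul_le_mul_of_nonneg_left _ hβ0
            apply mul_le_mul_of_nonneg_left _ (by linarith)
            linarith
  -- The deviation moves to `s` everything spent or saved outside `P`, and a fraction `c` of what is
  -- spent on `P`.
  have hdev : ∀ c, 0 ≤ c → c ≤ 1 →
      duoShare θ (G.α s) (G.B j - p + c * p) (x i s)
        ≤ c * g + β * ((1 + θ) / 2 * (G.B j - p)) := by
    intro c hc0 hc1
    set z := G.B j - p + c * p
    have hz : 0 ≤ z := add_nonneg hR0 (mul_nonneg hc0 hp0)
    let t : Ω → ℝ := fun ω =>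
      (if ω ∈ P then (1 - c) * x j ω else 0) + if ω = s then z else 0
    have hmem : t ∈ G.strategies j := by
      constructor
      · intro ω
        have : 0 ≤ (1 - c) * x j ω := mul_nonneg (by linarith) (hn _ _)
        simp only [t]
        split_ifs <;> linarith
      · simp only [t, Finset.sum_add_distrib, Finset.sum_ite_mem, Finset.univ_inter,
          Finset.sum_ite_eq', Finset.mem_univ, if_true, ← Finset.mul_sum]
        simp only [z]
        linarith
    have h := deviation_le hθ0 hθ1 hx hij.symm hmem
    have hle : ∑ ω, ((if ω ∈ P then (1 - c) * (G.α ω * x j ω) else 0)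
        + if ω = s then duoShare θ (G.α ω) z (x i ω) else 0)
        ≤ ∑ ω, duoShare θ (G.α ω) (t ω) (x i ω) := Finset.sum_le_sum fun ω _ => by
      by_cases hω : ω ∈ P
      · have hωs : ω ≠ s := fun h => hsP (h ▸ hω)
        simp only [t, hω, hωs, if_true, if_false, add_zero, ((hP ω).1 hω).2]
        rw [duoShare_zero_right hθ0 (mul_nonneg (by linarith) (hn _ _))]
        linarith
      · by_cases hωs : ω = s
        · simp [t, hωs, hsP]
        · simp only [t, hω, hωs, if_false, add_zero]
          exact duoShare_nonneg (G.α_pos ω).le le_rfl (hn _ _)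
    simp only [Finset.sum_add_distrib, Finset.sum_ite_mem, Finset.univ_inter,
      Finset.sum_ite_eq', Finset.mem_univ, if_true, ← Finset.mul_sum] at hle
    linarith
  have hy := hn i s
  rcases hy.eq_or_lt with hy0 | hy0
  · have h := hdev 1 zero_le_one le_rfl
    rw [← hy0, duoShare_zero_right hθ0 (by linarith)] at h
    have h1 : β * ((1 + θ) / 2 * (G.B j - p)) ≤ β * (G.B j - p) :=
      mul_le_mul_of_nonneg_left (by nlinarith) hβ0
    have h2 := mul_lt_mul_of_pos_right hβs hBj
    linarith
  -- Either the budget outside `P` already buys a share of `s` (`c = 0`), or `c` is chosen so that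
  -- exactly the threshold `θ * x i s` is reached.
  · rcases le_or_gt (θ * x i s) (G.B j - p) with hR | hR
    · have h := hdev 0 le_rfl zero_le_one
      rw [zero_mul, zero_mul, add_zero, zero_add] at h
      have hRpos : 0 < (1 + θ) / 2 * (G.B j - p) :=
        mul_pos (by linarith) ((mul_pos hθ0 hy0).trans_le hR)
      have h1 : G.α s * ((1 + θ) / 2 * (G.B j - p))
          ≤ duoShare θ (G.α s) (G.B j - p) (x i s) := by
        rcases lt_or_ge (x i s) (θ * (G.B j - p)) with hd | hd
        · rw [duoShare_of_dominates hθ0 hθ1 hR0 hd]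
          exact mul_le_mul_of_nonneg_left (by nlinarith) hA.le
        · rw [duoShare_of_both hR hd, mul_div_assoc]
          exact mul_le_mul_of_nonneg_left (by linarith) hA.le
      have h2 := mul_lt_mul_of_pos_right hβs hRpos
      linarith
    · have hppos : 0 < p := by linarith
      have h := hdev ((θ * x i s - (G.B j - p)) / p) (div_nonneg (by linarith) hp0)
        ((div_le_one hppos).2 (by linarith))
      rw [div_mul_cancel₀ _ hppos.ne', add_sub_cancel] at h
      have h1 := half_le_duoShare (θ := θ) hA.le (mul_nonneg hθ0.le hy) hy le_rfl
      have h2 : (θ * x i s - (G.B j - p)) / p * g ≤ β * (θ * x i s - (G.B j - p)) := by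
        rw [div_mul_eq_mul_div, div_le_iff₀ hppos]
        have := mul_le_mul_of_nonneg_left hgp (show 0 ≤ θ * x i s - (G.B j - p) by linarith)
        linarith
      have h3 : β * ((1 + θ) / 2 * (G.B j - p)) ≤ β * (G.B j - p) :=
        mul_le_mul_of_nonneg_left (by nlinarith) hβ0
      have hθy := mul_pos hθ0 hy0
      have h4 := mul_lt_mul_of_pos_right hβs hθy
      have h5 : G.α s * (θ * x i s) ≤ G.α s * (θ * x i s + x i s) / 2 := by
        rw [mul_div_assoc]
        exact mul_le_mul_of_nonneg_left (by nlinarith) hA.le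
      linarith

end Nonexistence

/-! ### Bounds on the prices, and when all equilibria are optimal. -/

section Prices

variable {m : ℕ} {G : SharedEffortGame (Fin 2) (Fin m)} {θ : ℝ} {k : ℕ}
  {x : Fin 2 → Fin m → ℝ} {s : Fin m}

lemma IsCase.exists_mem_steep (hG : G.IsCase θ k) (hk : 1 ≤ k) : ∃ s, s ∈ G.steep :=
  Finset.card_pos.1 (by rw [hG.2.1]; exact hk)

lemma le_socialWelfare (hθ0 : 0 < θ) (hθ1 : θ < 1) (hk : 1 ≤ k) (hG : G.IsCase θ k)
    (hs : s ∈ G.steep) (hx : x ∈ G.equilibria θ) :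
    (k : ℝ) / (k + θ) * (G.α s * (G.B 0 + G.B 1)) ≤ G.socialWelfare θ x := by
  have hk' : (1 : ℝ) ≤ k := by exact_mod_cast hk
  have h0 := G.B_pos 0
  have h1 := G.B_pos 1
  have hA := G.α_pos s
  have hkθ : 0 < (k : ℝ) + θ := by linarith
  rcases le_or_gt (θ * G.B 1) (G.B 0) with hB | hB
  · refine le_trans ?_ (le_socialWelfare_of_comparable (s := s) hθ0 hθ1 hx ?_ hB)
    · apply mul_le_of_le_one_left (by positivity)
      rw [div_le_one hkθ]
      linarith
    · nlinarith [hG.1]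
  · refine le_trans ?_ (mul_budget_le_socialWelfare (s := s) hθ0 hθ1 hx hB)
    rw [div_mul_eq_mul_div, div_le_iff₀ hkθ]
    -- Otherwise a share in the rich player's smallest steep contribution, at most B₁/k, would be
    -- affordable, contradicting the existence of an equilibrium.
    have hlt : (k : ℝ) * G.B 0 < θ * G.B 1 := by
      by_contra! hle
      obtain ⟨t, ht, htB⟩ := exists_mem_steep_le hx.1 ⟨s, hs⟩ 1
      rw [hG.2.1] at htB
      refine notMem_equilibria hθ0 hθ1 (i := 1) (j := 0) (by decide) hB ht ?_ hx
      have : (k : ℝ) * (θ * x 1 t) ≤ k * G.B 0 := by nlinarith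
      exact le_of_mul_le_mul_left this (by linarith)
    nlinarith

lemma optWelfare_pos (hθ0 : 0 < θ) (hθ1 : θ < 1) (hs : s ∈ G.steep) : 0 < G.optWelfare θ := by
  rw [optWelfare_eq hθ0 hθ1 hs]
  exact mul_pos (G.α_pos s) (add_pos (G.B_pos 0) (G.B_pos 1))

lemma bddAbove_welfare (hθ0 : 0 < θ) (hθ1 : θ < 1) (hs : s ∈ G.steep) :
    BddAbove (G.socialWelfare θ '' G.equilibria θ) := by
  refine ⟨G.optWelfare θ, ?_⟩
  rintro _ ⟨x, hx, rfl⟩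
  rw [optWelfare_eq hθ0 hθ1 hs]
  exact socialWelfare_le hθ0 hθ1 hs hx.1

lemma bddBelow_welfare (hθ0 : 0 < θ) (hθ1 : θ < 1) :
    BddBelow (G.socialWelfare θ '' G.equilibria θ) := by
  refine ⟨0, ?_⟩
  rintro _ ⟨x, hx, rfl⟩
  rw [socialWelfare_eq_add (i := 0) (j := 1) (by decide)]
  exact add_nonneg (utility_nonneg hθ0 hθ1 hx.1 _) (utility_nonneg hθ0 hθ1 hx.1 _)

lemma le_PoA_of_forall (hθ0 : 0 < θ) (hθ1 : θ < 1) (hs : s ∈ G.steep)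
    (hG : (G.equilibria θ).Nonempty) {c : ℝ}
    (h : ∀ x ∈ G.equilibria θ, c * (G.α s * (G.B 0 + G.B 1)) ≤ G.socialWelfare θ x) :
    c ≤ G.PoA θ := by
  rw [PoA, le_div_iff₀ (optWelfare_pos hθ0 hθ1 hs), optWelfare_eq hθ0 hθ1 hs]
  apply le_csInf (hG.image _)
  rintro _ ⟨x, hx, rfl⟩
  exact h x hx

lemma PoA_le_of_mem (hθ0 : 0 < θ) (hθ1 : θ < 1) (hs : s ∈ G.steep)
    (hx : x ∈ G.equilibria θ) :
    G.PoA θ * (G.α s * (G.B 0 + G.B 1)) ≤ G.socialWelfare θ x := by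
  rw [← optWelfare_eq hθ0 hθ1 hs, PoA, div_mul_cancel₀ _ (optWelfare_pos hθ0 hθ1 hs).ne']
  exact csInf_le (bddBelow_welfare hθ0 hθ1) ⟨x, hx, rfl⟩

lemma PoS_le_of_forall (hθ0 : 0 < θ) (hθ1 : θ < 1) (hs : s ∈ G.steep)
    (hG : (G.equilibria θ).Nonempty) {c : ℝ}
    (h : ∀ x ∈ G.equilibria θ, G.socialWelfare θ x ≤ c * (G.α s * (G.B 0 + G.B 1))) :
    G.PoS θ ≤ c := by
  rw [PoS, div_le_iff₀ (optWelfare_pos hθ0 hθ1 hs), optWelfare_eq hθ0 hθ1 hs]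
  apply csSup_le (hG.image _)
  rintro _ ⟨x, hx, rfl⟩
  exact h x hx

lemma le_PoS_of_mem (hθ0 : 0 < θ) (hθ1 : θ < 1) (hs : s ∈ G.steep)
    (hx : x ∈ G.equilibria θ) {c : ℝ}
    (h : c * (G.α s * (G.B 0 + G.B 1)) ≤ G.socialWelfare θ x) :
    c ≤ G.PoS θ := by
  rw [PoS, le_div_iff₀ (optWelfare_pos hθ0 hθ1 hs), optWelfare_eq hθ0 hθ1 hs]
  exact h.trans (le_csSup (bddAbove_welfare hθ0 hθ1 hs) ⟨x, hx, rfl⟩)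

lemma PoA_le_PoS (hθ0 : 0 < θ) (hθ1 : θ < 1) (hs : s ∈ G.steep)
    (hG : (G.equilibria θ).Nonempty) : G.PoA θ ≤ G.PoS θ := by
  obtain ⟨x, hx⟩ := hG
  exact le_PoS_of_mem hθ0 hθ1 hs hx (PoA_le_of_mem hθ0 hθ1 hs hx)

lemma PoS_le_one (hθ0 : 0 < θ) (hθ1 : θ < 1) (hs : s ∈ G.steep)
    (hG : (G.equilibria θ).Nonempty) : G.PoS θ ≤ 1 :=
  PoS_le_of_forall hθ0 hθ1 hs hG fun x hx => by
    rw [one_mul]; exact socialWelfare_le hθ0 hθ1 hs hx.1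

/-- If all equilibria of a game are optimal, then `k * θ ≤ 1`. -/
lemma mul_le_one_of_PoA_eq_one (hθ0 : 0 < θ) (hθ1 : θ < 1) (hk : 1 ≤ k)
    (hG : G.IsCase θ k) (h : G.PoA θ = 1) : (k : ℝ) * θ ≤ 1 := by
  obtain ⟨s, hs⟩ := hG.exists_mem_steep hk
  have hk' : (1 : ℝ) ≤ k := by exact_mod_cast hk
  obtain ⟨x, hx⟩ := hG.2.2
  have hn := profiles_nonneg hx.1
  have hA := G.α_pos s
  have h01 : (0 : Fin 2) ≠ 1 := by decide
  have hopt : ∀ z ∈ G.equilibria θ, G.α s * (G.B 0 + G.B 1) ≤ G.socialWelfare θ z :=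
    fun z hz => by simpa [h] using PoA_le_of_mem hθ0 hθ1 hs hz
  have hsw := hopt x hx
  have hsw' := socialWelfare_eq (G := G) hθ0 hθ1 hn h01
  have hadd := socialWelfare_eq_add (G := G) (θ := θ) (x := x) h01
  have hv0 := sum_α_mul_le hs hx.1 0
  have hv1 := sum_α_mul_le hs hx.1 1
  have hB0 := G.B_pos 0
  have hB1 := G.B_pos 1
  rcases le_or_gt (θ * G.B 1) (G.B 0) with hB | hB
  · by_contra! hkθ
    have hB' : θ * G.B 0 ≤ G.B 1 := by nlinarith [hG.1]
    have m0 := matching_le_utility hθ0 hθ1 hx h01 hB s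
    obtain ⟨t, ht, htB⟩ := exists_mem_steep_le hx.1 ⟨s, hs⟩ 0
    have hst := α_eq_of_mem_steep ht hs
    rw [hG.2.1] at htB
    have hc := concentrate_le_utility (s := t) hθ0 hθ1 hx h01.symm (by
      have : (k : ℝ) * x 0 t < k * (θ * G.B 1) := by nlinarith [hG.1]
      exact lt_of_mul_lt_mul_left this (by linarith))
    rw [hst] at hc
    have hV1 : ∑ ω, G.α ω * x 1 ω = G.α s * G.B 1 := by linarith
    have hV0 : ∑ ω, G.α ω * x 0 ω = G.α s * G.B 0 := by linarith
    have hs1 := mul_le_mul_of_nonneg_left (hx.1 1).2 (mul_pos hA hθ0).le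
    have hs0 := mul_le_mul_of_nonneg_left (hx.1 0).2 (mul_pos hA hθ0).le
    -- Matching gives player 0 at least half of the optimum and concentrating on `t` gives player 1
    -- at least A(B₁ + x₀(t)); together they cannot exceed the optimum.
    have hzero : G.B 0 - G.B 1 - 2 * x 0 t ≥ 0 := by
      have : 0 ≤ G.α s * (G.B 0 - G.B 1 - 2 * x 0 t) := by
        rw [hV1] at m0
        linarith
      exact nonneg_of_mul_nonneg_right this hA
    have hxt : x 0 t = 0 := by linarith [hn 0 t, hG.1]
    have hBB : G.B 0 = G.B 1 := by linarith [hn 0 t, hG.1]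
    -- With equal budgets B, matching and putting the remainder on the empty project `t` earns
    -- player 1 an extra (1 - θ)AB/2 beyond her half.
    have m1 := matching_le_utility_of_eq_zero hθ0 hθ1 hx h01.symm hB' hxt
    rw [hst, hV0, hBB] at m1
    rw [hV1, hBB] at m0
    rw [hBB] at hs0 hsw hV0
    have := mul_pos hA (mul_pos hB1 (sub_pos.2 hθ1))
    linarith
  · exfalso
    -- Optimality leaves the gentle projects empty and the steep ones pay the poor player nothing.
    -- She may thus withdraw all contributions, which yields a suboptimal equilibrium.
    have hzero : ∀ ω, duoShare θ (G.α ω) (x 0 ω) (x 1 ω) = 0 := by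
      intro ω
      by_cases hω : ω ∈ G.steep
      · exact duoShare_poor_steep hθ0 hθ1 hx h01.symm hB hω
      · have hgap : ∑ ω, (G.α s - G.α ω) * (x 0 ω + x 1 ω) ≤ 0 := by
          have e : ∑ ω, (G.α s - G.α ω) * (x 0 ω + x 1 ω)
              = G.α s * (∑ ω, x 0 ω + ∑ ω, x 1 ω)
                - (∑ ω, G.α ω * x 0 ω + ∑ ω, G.α ω * x 1 ω) := by
            rw [← Finset.sum_add_distrib, ← Finset.sum_add_distrib, Finset.mul_sum,
              ← Finset.sum_sub_distrib]
            exact Finset.sum_congr rfl fun _ _ => by ring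
          rw [e]
          have := mul_le_mul_of_nonneg_left (add_le_add (hx.1 0).2 (hx.1 1).2) hA.le
          linarith
        have hsingle : (G.α s - G.α ω) * (x 0 ω + x 1 ω) ≤ 0 :=
          (Finset.single_le_sum (f := fun ω => (G.α s - G.α ω) * (x 0 ω + x 1 ω))
            (fun ω _ => mul_nonneg (sub_nonneg.2 (α_le_of_mem_steep hs ω))
              (add_nonneg (hn 0 ω) (hn 1 ω))) (Finset.mem_univ ω)).trans hgap
        have hα := α_lt_of_notMem_steep hs hω
        have hle : x 0 ω + x 1 ω ≤ 0 := by
          by_contra! hc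
          have := mul_pos (sub_pos.2 hα) hc
          linarith
        have e0 : x 0 ω = 0 := by linarith [hn 0 ω, hn 1 ω]
        have e1 : x 1 ω = 0 := by linarith [hn 0 ω, hn 1 ω]
        rw [e0, e1, duoShare_zero_right hθ0 le_rfl, mul_zero]
    set z : Fin 2 → Fin m → ℝ := Function.update x 0 0 with hz
    have z0 : z 0 = 0 := by simp [z]
    have z1 : z 1 = x 1 := by simp [z]
    have hzmem : z ∈ G.profiles := by
      intro l
      fin_cases l
      · change z 0 ∈ _
        rw [z0]
        exact ⟨fun _ => le_rfl, by simpa using hB0.le⟩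
      · change z 1 ∈ _
        rw [z1]
        exact hx.1 1
    have hV1 : ∑ ω, G.α ω * x 1 ω = G.α s * G.B 1 := by linarith
    have hzeq : z ∈ G.equilibria θ := by
      refine mem_equilibria_of hθ0 hθ1 hzmem (fun t ht => ?_) (fun t ht => ?_)
      · rw [z0, z1]
        have h1 := deviation_le hθ0 hθ1 hx h01 ht
        rw [utility_eq_sum_duoShare hθ0 hθ1 hn h01, Finset.sum_congr rfl fun ω _ => hzero ω,
          Finset.sum_const_zero] at h1
        exact h1.trans (Finset.sum_nonneg fun ω _ =>
          duoShare_nonneg (G.α_pos ω).le le_rfl (hn 1 ω))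
      · rw [z0, z1]
        simp only [Pi.zero_apply]
        rw [Finset.sum_congr rfl fun ω _ => duoShare_zero_right hθ0 (ht.1 ω),
          Finset.sum_congr rfl fun ω _ => duoShare_zero_right hθ0 (hn 1 ω), hV1]
        calc ∑ ω, G.α ω * t ω ≤ ∑ ω, G.α s * t ω := Finset.sum_le_sum fun ω _ =>
              mul_le_mul_of_nonneg_right (α_le_of_mem_steep hs ω) (ht.1 ω)
          _ = G.α s * ∑ ω, t ω := by rw [Finset.mul_sum]
          _ ≤ _ := mul_le_mul_of_nonneg_left ht.2 hA.le
    have hbad := hopt z hzeq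
    rw [socialWelfare_eq hθ0 hθ1 (profiles_nonneg hzmem) h01, z0, z1, hV1] at hbad
    simp only [Pi.zero_apply, mul_zero, Finset.sum_const_zero] at hbad
    have := mul_pos hA hB0
    linarith

end Prices

end SharedEffortGame

namespace SharedEffortGame

/-! ### Games with equal projects: both prices can be near or at 1. -/

section EvenGame

/-- The game with `k` projects of coefficient `1` and with budgets `b` and `1`. -/
def evenGame (k : ℕ) {b : ℝ} (hb : 0 < b) : SharedEffortGame (Fin 2) (Fin k) where
  B := ![b, 1]
  α := fun _ => 1
  B_pos := fun i => by fin_cases i <;> simp [hb]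
  α_pos := fun _ => one_pos

variable {k : ℕ} {b θ : ℝ} (hb : 0 < b)

lemma steep_evenGame : (evenGame k hb).steep = Finset.univ := by
  ext ω
  simp [steep, evenGame]

/-- The poor player cannot reach the threshold θ/k anywhere, so she is indifferent, while the rich
player already receives the whole value 1 + b. -/
lemma evenGame_single_mem_equilibria (hθ0 : 0 < θ) (hθ1 : θ < 1) (hbk : b < θ / k)
    (s : Fin k) :
    (![Pi.single s b, fun _ => 1 / (k : ℝ)] : Fin 2 → Fin k → ℝ)
      ∈ (evenGame k hb).equilibria θ := by
  have hk : (0 : ℝ) < k := by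
    have : 0 < k := s.pos
    exact_mod_cast this
  have hlt : ∀ t : ℝ, t ≤ b → t < θ * (1 / (k : ℝ)) := fun t ht => by
    rw [mul_one_div]
    exact ht.trans_lt hbk
  have hs0 : ∀ ω, 0 ≤ (Pi.single s b : Fin k → ℝ) ω := fun ω => by
    rw [Pi.single_apply]; split_ifs <;> linarith
  have hsb : ∀ ω, (Pi.single s b : Fin k → ℝ) ω ≤ b := fun ω => by
    rw [Pi.single_apply]; split_ifs <;> linarith
  have hk1 : (0 : ℝ) ≤ 1 / k := by positivity
  apply mem_equilibria_of hθ0 hθ1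
  · intro i
    fin_cases i
    · exact ⟨hs0, by simp [evenGame]⟩
    · exact ⟨fun _ => hk1, by simp [evenGame, hk.ne']⟩
  · intro t ht
    simp only [Matrix.cons_val_zero, Matrix.cons_val_one]
    rw [Finset.sum_congr rfl fun ω _ => duoShare_of_lt (hlt _ (hsb ω)),
      Finset.sum_congr rfl fun ω _ => duoShare_of_lt (hlt (t ω) ?_)]
    exact (Finset.single_le_sum (fun ω _ => ht.1 ω) (Finset.mem_univ ω)).trans ht.2
  · intro t ht
    simp only [Matrix.cons_val_zero, Matrix.cons_val_one]
    rw [Finset.sum_congr rfl fun ω _ => duoShare_of_dominates hθ0 hθ1 hk1 (hlt _ (hsb ω))]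
    have h2 : ∑ ω, t ω ≤ 1 := ht.2
    calc _ ≤ ∑ ω, 1 * (t ω + (Pi.single s b : Fin k → ℝ) ω) :=
          Finset.sum_le_sum fun ω _ => duoShare_le zero_le_one (ht.1 ω) (hs0 ω)
      _ ≤ 1 + b := by
          simp only [one_mul, Finset.sum_add_distrib]
          simp only [Finset.sum_pi_single', Finset.mem_univ, if_true]
          linarith
      _ = _ := by
          simp only [evenGame, one_mul, Finset.sum_add_distrib]
          simp [hk.ne']

lemma isCase_evenGame (hθ0 : 0 < θ) (hθ1 : θ < 1) (hk : 1 ≤ k) (hbk : b < θ / k) :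
    (evenGame k hb).IsCase θ k := by
  have hk' : (1 : ℝ) ≤ k := by exact_mod_cast hk
  refine ⟨?_, by simp [steep_evenGame], _, evenGame_single_mem_equilibria hb hθ0 hθ1 hbk ⟨0, hk⟩⟩
  have : θ / k ≤ 1 := (div_le_one (by linarith)).2 (by linarith)
  simp only [evenGame, Matrix.cons_val_zero, Matrix.cons_val_one]
  linarith

lemma one_le_PoS_evenGame (hθ0 : 0 < θ) (hθ1 : θ < 1) (hk : 1 ≤ k) (hbk : b < θ / k) :
    1 ≤ (evenGame k hb).PoS θ := by
  have hk0 : (k : ℝ) ≠ 0 := by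
    have : k ≠ 0 := by omega
    exact_mod_cast this
  have hs : (⟨0, hk⟩ : Fin k) ∈ (evenGame k hb).steep := by simp [steep_evenGame]
  have hx := evenGame_single_mem_equilibria hb hθ0 hθ1 hbk ⟨0, hk⟩
  refine le_PoS_of_mem hθ0 hθ1 hs hx (le_of_eq ?_)
  rw [socialWelfare_eq hθ0 hθ1 (profiles_nonneg hx.1) (show (0 : Fin 2) ≠ 1 by decide)]
  simp [evenGame, hk0]

lemma le_PoA_evenGame (hθ0 : 0 < θ) (hθ1 : θ < 1) (hk : 1 ≤ k) (hbk : b < θ / k) :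
    1 / (1 + b) ≤ (evenGame k hb).PoA θ := by
  have hk' : (1 : ℝ) ≤ k := by exact_mod_cast hk
  have hs : (⟨0, hk⟩ : Fin k) ∈ (evenGame k hb).steep := by simp [steep_evenGame]
  refine le_PoA_of_forall hθ0 hθ1 hs (isCase_evenGame hb hθ0 hθ1 hk hbk).2.2 fun x hx => ?_
  have hbθ : b < θ := hbk.trans_le (div_le_self hθ0.le hk')
  have := mul_budget_le_socialWelfare (s := ⟨0, hk⟩) hθ0 hθ1 hx (by simpa [evenGame] using hbθ)
  refine le_trans (le_of_eq ?_) this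
  simp only [evenGame, Matrix.cons_val_zero, Matrix.cons_val_one]
  have : 1 + b ≠ 0 := by linarith
  field_simp
  ring

/-- Since θ ≤ 1/k, not even a whole budget dominates a project, so a deviator gets at most half of
each project, hence at most 1 in total. -/
lemma evenGame_one_mem_equilibria (hθ0 : 0 < θ) (hθ1 : θ < 1) (hk : 1 ≤ k)
    (hkθ : (k : ℝ) * θ ≤ 1) :
    (fun _ _ => 1 / (k : ℝ) : Fin 2 → Fin k → ℝ) ∈ (evenGame k one_pos).equilibria θ := by
  have hk' : (0 : ℝ) < k := by exact_mod_cast hk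
  have hk1 : (0 : ℝ) ≤ 1 / k := by positivity
  have hB : ∀ i, (evenGame k one_pos).B i = 1 := fun i => by
    fin_cases i <;> simp [evenGame]
  have hdev : ∀ i, ∀ t ∈ (evenGame k one_pos).strategies i,
      ∑ ω, duoShare θ ((evenGame k one_pos).α ω) (t ω) (1 / (k : ℝ))
      ≤ ∑ ω, duoShare θ ((evenGame k one_pos).α ω) (1 / (k : ℝ)) (1 / (k : ℝ)) := by
    intro i t ht
    have ht2 : ∑ ω, t ω ≤ 1 := by simpa [hB] using ht.2
    have hmatch : θ * (1 / (k : ℝ)) ≤ 1 / k := mul_le_of_le_one_left hk1 hθ1.le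
    calc _ ≤ ∑ ω, 1 * (t ω + 1 / (k : ℝ)) / 2 := Finset.sum_le_sum fun ω _ => by
          have h1 : t ω ≤ 1 :=
            (Finset.single_le_sum (fun ω _ => ht.1 ω) (Finset.mem_univ ω)).trans ht2
          refine duoShare_le_half zero_le_one (ht.1 ω) hk1 ?_
          rw [le_div_iff₀ hk']
          nlinarith [ht.1 ω, mul_le_mul_of_nonneg_left hkθ (ht.1 ω)]
      _ ≤ 1 := by
          rw [← Finset.sum_div]
          simp only [one_mul, Finset.sum_add_distrib]
          simp only [Finset.sum_const, Finset.card_univ, Fintype.card_fin, nsmul_eq_mul,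
            mul_one_div_cancel hk'.ne']
          linarith
      _ = _ := by
          rw [Finset.sum_congr rfl fun ω _ => duoShare_of_both hmatch hmatch]
          simp only [evenGame, Finset.sum_const, Finset.card_univ, Fintype.card_fin,
            nsmul_eq_mul]
          field_simp
          norm_num
  refine mem_equilibria_of hθ0 hθ1 (fun i => ⟨fun _ => hk1, ?_⟩) (hdev 0) (hdev 1)
  rw [hB]
  simp [hk'.ne']

lemma isCase_evenGame_one (hθ0 : 0 < θ) (hθ1 : θ < 1) (hk : 1 ≤ k) (hkθ : (k : ℝ) * θ ≤ 1) :
    (evenGame k one_pos).IsCase θ k :=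
  ⟨by simp [evenGame], by simp [steep_evenGame], _, evenGame_one_mem_equilibria hθ0 hθ1 hk hkθ⟩

lemma one_le_PoA_evenGame_one (hθ0 : 0 < θ) (hθ1 : θ < 1) (hk : 1 ≤ k)
    (hkθ : (k : ℝ) * θ ≤ 1) : 1 ≤ (evenGame k one_pos).PoA θ := by
  have hs : (⟨0, hk⟩ : Fin k) ∈ (evenGame k one_pos).steep := by simp [steep_evenGame]
  refine le_PoA_of_forall hθ0 hθ1 hs (isCase_evenGame_one hθ0 hθ1 hk hkθ).2.2 fun x hx => ?_
  rw [one_mul]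
  exact le_socialWelfare_of_comparable hθ0 hθ1 hx (by simpa [evenGame] using hθ1.le)
    (by simpa [evenGame] using hθ1.le)

end EvenGame

/-! ### Games with a decoy project: the lower bound is sharp. -/

section DecoyGame

/-- The game with `k` projects of coefficient `1`, one project of coefficient `η`, and with
budgets `b` and `1`. -/
def decoyGame (k : ℕ) {b η : ℝ} (hb : 0 < b) (hη : 0 < η) :
    SharedEffortGame (Fin 2) (Fin (k + 1)) where
  B := ![b, 1]
  α := fun ω => if ω = Fin.last k then η else 1
  B_pos := fun i => by fin_cases i <;> simp [hb]
  α_pos := fun ω => by split_ifs <;> linarith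

variable {k : ℕ} {b η θ : ℝ} (hb : 0 < b) (hη : 0 < η)

lemma mem_steep_decoyGame (hk : 1 ≤ k) (hη1 : η < 1) (ω : Fin (k + 1)) :
    ω ∈ (decoyGame k hb hη).steep ↔ ω ≠ Fin.last k := by
  rw [mem_steep]
  simp only [decoyGame]
  constructor
  · rintro h rfl
    have h0 := h 0
    have : (0 : Fin (k + 1)) ≠ Fin.last k := by
      intro h; have := congrArg Fin.val h; simp at this; omega
    simp only [this, if_true, if_false] at h0
    linarith
  · intro h ω'
    rw [if_neg h]
    split_ifs <;> linarith

lemma card_steep_decoyGame (hk : 1 ≤ k) (hη1 : η < 1) :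
    (decoyGame k hb hη).steep.card = k := by
  have : (decoyGame k hb hη).steep = Finset.univ.erase (Fin.last k) := by
    ext ω
    simp [mem_steep_decoyGame hb hη hk hη1]
  rw [this, Finset.card_erase_of_mem (Finset.mem_univ _)]
  simp

/-- Joining the decoy project does not pay off for the rich player. -/
lemma mul_duoShare_le (hθ0 : 0 < θ) (hη : 0 < η) {t y : ℝ} (ht : 0 ≤ t) (hy : 0 ≤ y) :
    θ * duoShare θ η t y ≤ η * (1 + θ) * t := by
  by_cases h : t < θ * y
  · rw [duoShare_of_lt h]
    have : 0 ≤ η * (1 + θ) * t := by positivity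
    linarith
  · push Not at h
    have h1 := mul_le_mul_of_nonneg_left (duoShare_le (θ := θ) hη.le ht hy) hθ0.le
    nlinarith [mul_le_mul_of_nonneg_left h hη.le]

/-- Against an even spread the poor player can earn only on the decoy. For the rich player a unit
there returns at most η(1 + θ)/θ < 1, less than on a steep project. -/
lemma decoyGame_mem_equilibria (hθ0 : 0 < θ) (hθ1 : θ < 1) (hk : 1 ≤ k) (hbk : b < θ / k)
    (hηθ : η * (1 + θ) < θ) :
    (![fun ω => if ω = Fin.last k then b else 0,
        fun ω => if ω = Fin.last k then 0 else 1 / (k : ℝ)] : Fin 2 → Fin (k + 1) → ℝ)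
      ∈ (decoyGame k hb hη).equilibria θ := by
  have hk' : (0 : ℝ) < k := by exact_mod_cast hk
  have hk1 : (0 : ℝ) ≤ 1 / k := by positivity
  have hlt : ∀ t : ℝ, t ≤ b → t < θ * (1 / (k : ℝ)) := fun t ht => by
    rw [mul_one_div]
    exact ht.trans_lt hbk
  apply mem_equilibria_of hθ0 hθ1
  · intro i
    fin_cases i
    · refine ⟨fun ω => ?_, ?_⟩
      · simp only [Fin.zero_eta, Matrix.cons_val_zero]
        split_ifs <;> linarith
      · simp [decoyGame]
    · refine ⟨fun ω => ?_, ?_⟩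
      · simp only [Fin.mk_one, Matrix.cons_val_one, Matrix.cons_val_zero]
        split_ifs <;> linarith
      · simp [decoyGame, Fin.sum_univ_castSucc, Fin.castSucc_ne_last, hk'.ne']
  · intro t ht
    have hle : ∀ ω, t ω ≤ b := fun ω =>
      (Finset.single_le_sum (fun ω _ => ht.1 ω) (Finset.mem_univ ω)).trans ht.2
    simp only [Matrix.cons_val_zero, Matrix.cons_val_one, Fin.sum_univ_castSucc,
      Fin.castSucc_ne_last, if_true, if_false]
    rw [duoShare_zero_right hθ0 (ht.1 _), duoShare_zero_right hθ0 hb.le,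
      Finset.sum_congr rfl fun ω _ => duoShare_of_lt (hlt _ (hle (Fin.castSucc ω))),
      Finset.sum_congr rfl fun ω _ => duoShare_of_lt (hlt 0 hb.le)]
    have := mul_le_mul_of_nonneg_left (hle (Fin.last k)) ((decoyGame k hb hη).α_pos (Fin.last k)).le
    linarith
  · intro t ht
    have hsum : ∑ ω, t ω ≤ 1 := ht.2
    rw [Fin.sum_univ_castSucc] at hsum
    simp only [Matrix.cons_val_zero, Matrix.cons_val_one, Fin.sum_univ_castSucc,
      Fin.castSucc_ne_last, if_true, if_false, decoyGame]
    rw [Finset.sum_congr rfl fun ω _ => duoShare_zero_right hθ0 (ht.1 (Fin.castSucc ω)),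
      Finset.sum_congr rfl fun ω _ => duoShare_zero_right hθ0 hk1]
    have h1 : duoShare θ η (t (Fin.last k)) b ≤ t (Fin.last k) := by
      refine le_of_mul_le_mul_left ((mul_duoShare_le hθ0 hη (ht.1 _) hb.le).trans ?_) hθ0
      exact mul_le_mul_of_nonneg_right hηθ.le (ht.1 _)
    have h2 := duoShare_nonneg (θ := θ) hη.le le_rfl hb.le
    simp only [one_mul, Finset.sum_const, Finset.card_univ, Fintype.card_fin, nsmul_eq_mul,
      mul_one_div_cancel hk'.ne']
    linarith

lemma isCase_decoyGame (hθ0 : 0 < θ) (hθ1 : θ < 1) (hk : 1 ≤ k) (hbk : b < θ / k)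
    (hη1 : η < 1) (hηθ : η * (1 + θ) < θ) : (decoyGame k hb hη).IsCase θ k := by
  have hk' : (1 : ℝ) ≤ k := by exact_mod_cast hk
  refine ⟨?_, card_steep_decoyGame hb hη hk hη1, _,
    decoyGame_mem_equilibria hb hη hθ0 hθ1 hk hbk hηθ⟩
  have : θ / k ≤ 1 := (div_le_one (by linarith)).2 (by linarith)
  simp only [decoyGame, Matrix.cons_val_zero, Matrix.cons_val_one]
  linarith

/-- In an equilibrium of the decoy game, the poor player contributes to the decoy only. -/
lemma socialWelfare_decoyGame_le (hθ0 : 0 < θ) (hθ1 : θ < 1) (hk : 1 ≤ k) (hbk : b < θ / k)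
    (hη1 : η < 1) (hηθ : η * (1 + θ) < θ) {x : Fin 2 → Fin (k + 1) → ℝ}
    (hx : x ∈ (decoyGame k hb hη).equilibria θ) :
    (decoyGame k hb hη).socialWelfare θ x ≤ 1 + η * b := by
  have hn := profiles_nonneg hx.1
  have hk' : (1 : ℝ) ≤ k := by exact_mod_cast hk
  have h01 : (0 : Fin 2) ≠ 1 := by decide
  have hst := mem_steep_decoyGame hb hη hk hη1
  have hs : (0 : Fin (k + 1)) ∈ (decoyGame k hb hη).steep := (hst 0).2 (by
    intro h; have := congrArg Fin.val h; simp at this; omega)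
  have hαl : (decoyGame k hb hη).α (Fin.last k) = η := by simp [decoyGame]
  have hαc : ∀ ω : Fin k, (decoyGame k hb hη).α ω.castSucc = 1 := fun ω => by
    simp [decoyGame, Fin.castSucc_ne_last]
  have hα0 : (decoyGame k hb hη).α 0 = 1 := by
    simp [decoyGame, (hst 0).1 hs]
  have hB : (decoyGame k hb hη).B 0 < θ * (decoyGame k hb hη).B 1 := by
    have : b < θ := hbk.trans_le (div_le_self hθ0.le hk')
    simpa [decoyGame] using this
  have hlast : x 1 (Fin.last k) = 0 := by
    have h := surplus_le_of_rich hθ0 hθ1 hx h01.symm hB hs (n := Fin.last k)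
      (by simp [hst]) le_rfl (div_nonneg (hn 0 _) hθ0.le)
    have h2 := duoShare_nonneg (θ := θ) hη.le le_rfl (hn 0 (Fin.last k))
    rw [hα0, hαl] at h
    by_contra hne
    have hpos : 0 < x 1 (Fin.last k) := lt_of_le_of_ne (hn 1 _) (Ne.symm hne)
    have h3 := mul_duoShare_le hθ0 hη (hn 1 (Fin.last k)) (hn 0 (Fin.last k))
    have h4 := mul_lt_mul_of_pos_right hηθ hpos
    nlinarith
  have hpoor := deviation_le hθ0 hθ1 hx h01 (single_mem_strategies (Fin.last k) 0)
  have hzero : ∀ ω : Fin k, duoShare θ 1 (x 0 ω.castSucc) (x 1 ω.castSucc) = 0 := fun ω => by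
    have := duoShare_poor_steep hθ0 hθ1 hx h01.symm hB ((hst ω.castSucc).2 (Fin.castSucc_ne_last ω))
    rwa [hαc] at this
  have hB0 : (decoyGame k hb hη).B 0 = b := by simp [decoyGame]
  have h0 : ∑ ω, x 0 ω ≤ b := hB0 ▸ (hx.1 0).2
  have h1 : ∑ ω, x 1 ω ≤ 1 := (hx.1 1).2
  have hge : 0 ≤ ∑ ω : Fin k, duoShare θ 1
      ((Pi.single (Fin.last k) b : Fin (k + 1) → ℝ) ω.castSucc) (x 1 ω.castSucc) :=
    Finset.sum_nonneg fun ω _ => duoShare_nonneg zero_le_one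
      (by simp [Fin.castSucc_ne_last]) (hn 1 _)
  rw [utility_eq_sum_duoShare hθ0 hθ1 hn h01, Fin.sum_univ_castSucc, Fin.sum_univ_castSucc] at hpoor
  simp only [hαc, hαl, hB0, hlast, hzero, Pi.single_eq_same, Finset.sum_const_zero] at hpoor
  rw [duoShare_zero_right hθ0 hb.le, duoShare_zero_right hθ0 (hn 0 _)] at hpoor
  -- The decoy is the only project that pays the poor player, and having it to herself rewards the
  -- full budget.
  have hbx : b ≤ x 0 (Fin.last k) := le_of_mul_le_mul_left (by linarith) hη
  rw [socialWelfare_eq hθ0 hθ1 hn h01, Fin.sum_univ_castSucc, Fin.sum_univ_castSucc]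
  simp only [hαc, hαl, one_mul, hlast]
  rw [Fin.sum_univ_castSucc] at h0 h1
  have hx0 : 0 ≤ ∑ ω : Fin k, x 0 ω.castSucc := Finset.sum_nonneg fun ω _ => hn 0 _
  have hlb : x 0 (Fin.last k) = b := by linarith
  rw [hlb] at h0 ⊢
  linarith

lemma PoS_decoyGame_le (hθ0 : 0 < θ) (hθ1 : θ < 1) (hk : 1 ≤ k) (hbk : b < θ / k)
    (hη1 : η < 1) (hηθ : η * (1 + θ) < θ) :
    (decoyGame k hb hη).PoS θ ≤ (1 + η * b) / (1 + b) := by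
  have h0 : (0 : Fin (k + 1)) ≠ Fin.last k := by
    intro h; have := congrArg Fin.val h; simp at this; omega
  have hs : (0 : Fin (k + 1)) ∈ (decoyGame k hb hη).steep :=
    (mem_steep_decoyGame hb hη hk hη1 0).2 h0
  refine PoS_le_of_forall hθ0 hθ1 hs (isCase_decoyGame hb hη hθ0 hθ1 hk hbk hη1 hηθ).2.2
    fun x hx => ?_
  refine (socialWelfare_decoyGame_le hb hη hθ0 hθ1 hk hbk hη1 hηθ hx).trans (le_of_eq ?_)
  simp only [decoyGame, h0, if_false, Matrix.cons_val_zero, Matrix.cons_val_one]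
  have : 1 + b ≠ 0 := by linarith
  field_simp
  ring

end DecoyGame

end SharedEffortGame

namespace SharedEffortGame

/-! ### Infima, suprema and attainment over all games. -/

section Values

open Filter Topology

variable {θ : ℝ} {k : ℕ}

lemma lowerBound_poaValues (hθ0 : 0 < θ) (hθ1 : θ < 1) (hk : 1 ≤ k) :
    (k : ℝ) / (k + θ) ∈ lowerBounds (poaValues θ k) := by
  rintro _ ⟨m, G, hG, rfl⟩
  obtain ⟨s, hs⟩ := hG.exists_mem_steep hk
  exact le_PoA_of_forall hθ0 hθ1 hs hG.2.2 fun x hx => le_socialWelfare hθ0 hθ1 hk hG hs hx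

lemma lowerBound_posValues (hθ0 : 0 < θ) (hθ1 : θ < 1) (hk : 1 ≤ k) :
    (k : ℝ) / (k + θ) ∈ lowerBounds (posValues θ k) := by
  rintro _ ⟨m, G, hG, rfl⟩
  obtain ⟨s, hs⟩ := hG.exists_mem_steep hk
  exact (lowerBound_poaValues hθ0 hθ1 hk ⟨m, G, hG, rfl⟩).trans
    (PoA_le_PoS hθ0 hθ1 hs hG.2.2)

lemma one_mem_upperBounds_posValues (hθ0 : 0 < θ) (hθ1 : θ < 1) (hk : 1 ≤ k) :
    1 ∈ upperBounds (posValues θ k) := by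
  rintro _ ⟨m, G, hG, rfl⟩
  obtain ⟨s, hs⟩ := hG.exists_mem_steep hk
  exact PoS_le_one hθ0 hθ1 hs hG.2.2

lemma one_mem_upperBounds_poaValues (hθ0 : 0 < θ) (hθ1 : θ < 1) (hk : 1 ≤ k) :
    1 ∈ upperBounds (poaValues θ k) := by
  rintro _ ⟨m, G, hG, rfl⟩
  obtain ⟨s, hs⟩ := hG.exists_mem_steep hk
  exact (PoA_le_PoS hθ0 hθ1 hs hG.2.2).trans (PoS_le_one hθ0 hθ1 hs hG.2.2)

/-- A number which is at most the price of stability of all decoy games is at most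
`k / (k + θ)`. -/
lemma le_of_forall_decoyGame (hθ0 : 0 < θ) (hk : 1 ≤ k) {c : ℝ}
    (h : ∀ b η : ℝ, 0 < b → 0 < η → b < θ / k → η < 1 → η * (1 + θ) < θ →
      c ≤ (1 + η * b) / (1 + b)) : c ≤ (k : ℝ) / (k + θ) := by
  have hk' : (0 : ℝ) < k := by exact_mod_cast hk
  have hθk : 0 < θ / k := by positivity
  have hden : 1 + θ / k * (1 - 0) ≠ 0 := by linarith
  -- The games are taken along b = (θ/k)(1 - t) and η = tθ/(2(1 + θ)), which are admissible for 0 <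
  -- t < 1; as t → 0 the bound tends to 1/(1 + θ/k).
  have hcont : ContinuousAt (fun t : ℝ =>
      (1 + t * (θ / (2 * (1 + θ))) * (θ / k * (1 - t))) / (1 + θ / k * (1 - t))) 0 :=
    ContinuousAt.div (by fun_prop) (by fun_prop) hden
  have hval : (1 + 0 * (θ / (2 * (1 + θ))) * (θ / k * (1 - 0))) / (1 + θ / k * (1 - 0))
      = (k : ℝ) / (k + θ) := by
    have : (k : ℝ) + θ ≠ 0 := by linarith
    field_simp
    ring
  rw [← hval]
  refine ge_of_tendsto (hcont.tendsto.mono_left (nhdsWithin_le_nhds (s := Set.Ioi 0))) ?_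
  filter_upwards [Ioo_mem_nhdsGT (show (0 : ℝ) < 1 by norm_num)] with t ht
  obtain ⟨ht0, ht1⟩ := ht
  have h1 : θ / (2 * (1 + θ)) * (1 + θ) = θ / 2 := by
    have : 1 + θ ≠ 0 := by linarith
    field_simp
  have h2 : 0 < θ / (2 * (1 + θ)) := by positivity
  have h3 : θ / (2 * (1 + θ)) < 1 := (div_lt_one (by linarith)).2 (by linarith)
  refine h _ _ (mul_pos hθk (by linarith)) (mul_pos ht0 h2) ?_ ?_ ?_
  · nlinarith
  · nlinarith
  · rw [mul_assoc, h1]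
    nlinarith

lemma upperBound_lowerBounds_posValues (hθ0 : 0 < θ) (hθ1 : θ < 1) (hk : 1 ≤ k) :
    (k : ℝ) / (k + θ) ∈ upperBounds (lowerBounds (posValues θ k)) :=
  fun _ hc => le_of_forall_decoyGame hθ0 hk fun _ _ hb hη hbk hη1 hηθ =>
    (hc ⟨k + 1, decoyGame k hb hη, isCase_decoyGame hb hη hθ0 hθ1 hk hbk hη1 hηθ, rfl⟩).trans
      (PoS_decoyGame_le hb hη hθ0 hθ1 hk hbk hη1 hηθ)

lemma upperBound_lowerBounds_poaValues (hθ0 : 0 < θ) (hθ1 : θ < 1) (hk : 1 ≤ k) :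
    (k : ℝ) / (k + θ) ∈ upperBounds (lowerBounds (poaValues θ k)) := by
  refine fun c hc => upperBound_lowerBounds_posValues hθ0 hθ1 hk ?_
  rintro _ ⟨m, G, hG, rfl⟩
  obtain ⟨s, hs⟩ := hG.exists_mem_steep hk
  exact (hc ⟨m, G, hG, rfl⟩).trans (PoA_le_PoS hθ0 hθ1 hs hG.2.2)

lemma one_mem_posValues (hθ0 : 0 < θ) (hθ1 : θ < 1) (hk : 1 ≤ k) : 1 ∈ posValues θ k := by
  have hk' : (0 : ℝ) < k := by exact_mod_cast hk
  have hb : 0 < θ / k / 2 := by positivity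
  have hbk : θ / k / 2 < θ / k := half_lt_self (by positivity)
  have hcase := isCase_evenGame hb hθ0 hθ1 hk hbk
  exact ⟨k, evenGame k hb, hcase, le_antisymm (one_le_PoS_evenGame hb hθ0 hθ1 hk hbk)
    (one_mem_upperBounds_posValues hθ0 hθ1 hk ⟨k, _, hcase, rfl⟩)⟩

lemma one_le_of_mem_upperBounds_poaValues (hθ0 : 0 < θ) (hθ1 : θ < 1) (hk : 1 ≤ k) {c : ℝ}
    (hc : c ∈ upperBounds (poaValues θ k)) : 1 ≤ c := by
  have hk' : (0 : ℝ) < k := by exact_mod_cast hk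
  have hcont : ContinuousAt (fun b : ℝ => 1 / (1 + b)) 0 :=
    ContinuousAt.div (by fun_prop) (by fun_prop) (by norm_num)
  have hval : (1 : ℝ) / (1 + 0) = 1 := by norm_num
  rw [← hval]
  refine le_of_tendsto (hcont.tendsto.mono_left (nhdsWithin_le_nhds (s := Set.Ioi 0))) ?_
  filter_upwards [Ioo_mem_nhdsGT (show 0 < θ / (k : ℝ) by positivity)] with b hb
  exact (le_PoA_evenGame hb.1 hθ0 hθ1 hk hb.2).trans
    (hc ⟨k, _, isCase_evenGame hb.1 hθ0 hθ1 hk hb.2, rfl⟩)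

lemma one_mem_poaValues_iff (hθ0 : 0 < θ) (hθ1 : θ < 1) (hk : 1 ≤ k) :
    1 ∈ poaValues θ k ↔ (k : ℝ) * θ ≤ 1 := by
  constructor
  · rintro ⟨m, G, hG, h⟩
    exact mul_le_one_of_PoA_eq_one hθ0 hθ1 hk hG h.symm
  · intro hkθ
    have hcase := isCase_evenGame_one hθ0 hθ1 hk hkθ
    exact ⟨k, _, hcase, le_antisymm (one_le_PoA_evenGame_one hθ0 hθ1 hk hkθ)
      (one_mem_upperBounds_poaValues hθ0 hθ1 hk ⟨k, _, hcase, rfl⟩)⟩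

end Values

end SharedEffortGame

theorem mainTheorem7 (θ : ℝ) (hθ0 : 0 < θ) (hθ1 : θ < 1) (k : ℕ) (hk : 1 ≤ k) :
    (1 / 2 : ℝ) < (k : ℝ) / ((k : ℝ) + θ) ∧
    IsGLB (SharedEffortGame.posValues θ k) ((k : ℝ) / ((k : ℝ) + θ)) ∧
    IsGreatest (SharedEffortGame.posValues θ k) 1 ∧
    IsGLB (SharedEffortGame.poaValues θ k) ((k : ℝ) / ((k : ℝ) + θ)) ∧
    IsLUB (SharedEffortGame.poaValues θ k) 1 ∧
    (IsGreatest (SharedEffortGame.poaValues θ k) 1 ↔ (k : ℝ) * θ ≤ 1) := by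
  have hk' : (1 : ℝ) ≤ k := by exact_mod_cast hk
  have hub := SharedEffortGame.one_mem_upperBounds_poaValues hθ0 hθ1 hk
  refine ⟨?_, ⟨SharedEffortGame.lowerBound_posValues hθ0 hθ1 hk,
      SharedEffortGame.upperBound_lowerBounds_posValues hθ0 hθ1 hk⟩,
    ⟨SharedEffortGame.one_mem_posValues hθ0 hθ1 hk,
      SharedEffortGame.one_mem_upperBounds_posValues hθ0 hθ1 hk⟩,
    ⟨SharedEffortGame.lowerBound_poaValues hθ0 hθ1 hk,
      SharedEffortGame.upperBound_lowerBounds_poaValues hθ0 hθ1 hk⟩,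
    ⟨hub, fun c hc => SharedEffortGame.one_le_of_mem_upperBounds_poaValues hθ0 hθ1 hk hc⟩, ?_⟩
  · rw [div_lt_div_iff₀ two_pos (by linarith)]
    linarith
  · rw [← SharedEffortGame.one_mem_poaValues_iff hθ0 hθ1 hk]
    exact ⟨fun h => h.1, fun h => ⟨h, hub⟩⟩
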